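/- **Proposition (if the area of the Mandelbrot set is computable, then the Mandelbrot set is computable).** *Conventions.* A rational sequence $(q_n)$ is computable if $n\mapsto q_n$ is computed by a Turing machine; a real $x$ is *computable* if there is a computable rational sequence with $|q_n-x|<2^{-n}$ for all $n$, and *upper-computable* if it is the limit of a computable non-increasing rational sequence. In $\mathbb{C}=\mathbb{R}^2$ the *ideal points* are the points with rational coordinates, and an *ideal ball* is an open Euclidean ball $B(s,q)$ with $s$ an ideal point and $q>0$ rational. An open set is *lower-computable* if it is the union of a computable sequence of ideal balls. A closed set $K$ is *upper-computable* if its complement is a lower-computable open set, *lower-computable* if the relation $K\cap B\neq\emptyset$ is semi-decidable in the ideal ball $B$, and *computable* if it is both. On the compact square $Q=[-2,2]^2\subset\mathbb{C}$, with its rational points as ideal points, a Borel probability measure $\mu$ is *computable* if there is a computable sequence $(\mu_n)$ of finite rational convex combinations of Dirac measures at ideal points with $W_1(\mu_n,\mu)<2^{-n}$ for all $n$, where $$W_1(\mu,\nu)=\sup\Big\{\Big|\int f\,d\mu-\int f\,d\nu\Big| : f:Q\to\mathbb{R}\ \text{1-Lipschitz}\Big\};$$ a finite Borel measure on $Q$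 is *computable* if its total mass is a computable real and, unless it is zero, its normalization to a probability measure is computable. *Statement.* Let $f_c(z)=z^2+c$ and let $$\mathcal{M}=\{c\in\mathbb{C} : \sup_{n\in\mathbb{N}}|f_c^n(0)|<\infty\}$$ be the Mandelbrot set. Then: 1. $\mathbb{C}\setminus\mathcal{M}$ is a lower-computable open set. 2. $\mathcal{M}\subset Q$, and the area (Lebesgue measure) of $\mathcal{M}$ is an upper-computable real number. 3. The support of Lebesgue measure restricted to $\mathcal{M}$ is $\mathcal{M}$. 4. If the area of $\mathcal{M}$ is a computable real number, then Lebesgue measure restricted to $\mathcal{M}$, as a finite measure on $Q$, is a computable measure; its support, which is $\mathcal{M}$, is a lower-computable closed set; and $\mathcal{M}$ is a computable closed set. -/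

import Mathlib

open MeasureTheory Filter Topology

noncomputable section

namespace CompAnalysis

/-! ### Computability on metric spaces with a countable family of ideal points

A family `s : ι → X`, with `ι` effectively coded by natural numbers, plays the role of the
effectively enumerated dense sequence of ideal points. -/

/-- Codes of rational numbers: `(a, b, d)` stands for `(a - b) / (d + 1)`. -/
abbrev RatCode := ℕ × ℕ × ℕ

/-- The rational number with a given code. Every rational number has a code. -/
def ratOf (p : RatCode) : ℚ := ((p.1 : ℚ) - (p.2.1 : ℚ)) / ((p.2.2 : ℚ) + 1)

/-- `x` is a computable point of `(X, d, s)`: some computable sequence of ideal points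
approximates `x` up to `2 ^ (-n)`. -/
def IsComputablePoint {X ι : Type*} [Primcodable ι] (d : X → X → ℝ) (s : ι → X) (x : X) : Prop :=
  ∃ f : ℕ → ι, Computable f ∧ ∀ n : ℕ, d (s (f n)) x < (1 / 2 : ℝ) ^ n

/-- Computable real numbers: computable points of `ℝ`, with the rationals as ideal points. -/
def IsComputableReal (x : ℝ) : Prop :=
  IsComputablePoint (fun a b : ℝ => dist a b) (fun p : RatCode => (ratOf p : ℝ)) x

/-- Upper-computable real numbers: limits of computable non-increasing sequences of rationals. -/
def IsUpperComputableReal (x : ℝ) : Prop :=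
  ∃ f : ℕ → RatCode, Computable f ∧ Antitone (fun n => (ratOf (f n) : ℝ)) ∧
    Tendsto (fun n => (ratOf (f n) : ℝ)) atTop (𝓝 x)

/-- The ideal ball with code `(i, a, b)`: centre the ideal point `s i` and positive rational radius
`(a + 1) / (b + 1)`. -/
def idealBall {X ι : Type*} [PseudoMetricSpace X] (s : ι → X) (b : ι × ℕ × ℕ) : Set X :=
  Metric.ball (s b.1) (((b.2.1 : ℝ) + 1) / ((b.2.2 : ℝ) + 1))

/-- Lower-computable open sets: unions of computable sequences of ideal balls. -/
def IsLowerComputableOpen {X ι : Type*} [PseudoMetricSpace X] [Primcodable ι] (s : ι → X)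
    (U : Set X) : Prop :=
  ∃ f : ℕ → ι × ℕ × ℕ, Computable f ∧ U = ⋃ n, idealBall s (f n)

/-- Upper-computable closed sets: closed sets whose complement is lower-computable. -/
def IsUpperComputableClosed {X ι : Type*} [PseudoMetricSpace X] [Primcodable ι] (s : ι → X)
    (K : Set X) : Prop :=
  IsClosed K ∧ IsLowerComputableOpen s Kᶜ

/-- Lower-computable closed sets: the relation `K ∩ B ≠ ∅`, for ideal balls `B`, is
semi-decidable. -/
def IsLowerComputableClosed {X ι : Type*} [PseudoMetricSpace X] [Primcodable ι] (s : ι → X)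
    (K : Set X) : Prop :=
  IsClosed K ∧ REPred fun b : ι × ℕ × ℕ => (K ∩ idealBall s b).Nonempty

/-- Computable closed sets. -/
def IsComputableClosed {X ι : Type*} [PseudoMetricSpace X] [Primcodable ι] (s : ι → X)
    (K : Set X) : Prop :=
  IsLowerComputableClosed s K ∧ IsUpperComputableClosed s K

/-! ### Computable measures on a compact metric space -/

/-- The Wasserstein-Kantorovich distance `W₁` on Borel probability measures. -/
def wasserstein {X : Type*} [MetricSpace X] [CompactSpace X] [MeasurableSpace X] [BorelSpace X]
    (μ ν : ProbabilityMeasure X) : ℝ :=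
  ⨆ f : {f : X → ℝ // LipschitzWith 1 f},
    |(∫ x, f.1 x ∂(μ : Measure X)) - ∫ x, f.1 x ∂(ν : Measure X)|

/-- Codes of finite rational convex combinations: a non-empty list of pairs `(i, w)`, each
standing for the point `s i` with positive integer weight `w + 1`. -/
abbrev ConvexCode (ι : Type*) := (ι × ℕ) × List (ι × ℕ)

/-- The (unnormalized) weighted sum of Dirac masses `∑ (w + 1) δ_{s i}`. -/
def diracSum {X ι : Type*} [MeasurableSpace X] (s : ι → X) (l : List (ι × ℕ)) : Measure X :=
  (l.map fun p => ((p.2 + 1 : ℕ) : ENNReal) • Measure.dirac (s p.1)).sum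

/-- The total weight `∑ (w + 1)`. -/
def totalWeight {ι : Type*} (l : List (ι × ℕ)) : ℕ := (l.map fun p => p.2 + 1).sum

theorem diracSum_univ {X ι : Type*} [MeasurableSpace X] (s : ι → X) (l : List (ι × ℕ)) :
    diracSum s l Set.univ = (totalWeight l : ENNReal) := by
  induction l with
  | nil => simp [diracSum, totalWeight]
  | cons p l ih =>
    simp only [diracSum, totalWeight, List.map_cons, List.sum_cons] at ih ⊢
    rw [Measure.add_apply, ih]
    simp

theorem totalWeight_cons_ne_zero {ι : Type*} (p : ι × ℕ) (l : List (ι × ℕ)) :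
    totalWeight (p :: l) ≠ 0 := by
  simp [totalWeight]

/-- The ideal measure with a given code: a finite rational convex combination of Dirac measures
at ideal points, with coefficients `(w + 1) / ∑ (w + 1)`. -/
def idealMeasure {X ι : Type*} [MeasurableSpace X] (s : ι → X) (c : ConvexCode ι) :
    ProbabilityMeasure X :=
  ⟨((totalWeight (c.1 :: c.2) : ENNReal))⁻¹ • diracSum s (c.1 :: c.2), ⟨by
    rw [Measure.smul_apply, diracSum_univ, smul_eq_mul]
    exact ENNReal.inv_mul_cancel
      (by exact_mod_cast totalWeight_cons_ne_zero c.1 c.2) (ENNReal.natCast_ne_top _)⟩⟩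

/-- Computable probability measures: computable points of the space of Borel probability measures
with the distance `W₁` and the ideal measures. -/
def IsComputableProbabilityMeasure {X ι : Type*} [MetricSpace X] [CompactSpace X]
    [MeasurableSpace X] [BorelSpace X] [Primcodable ι] (s : ι → X) (μ : ProbabilityMeasure X) :
    Prop :=
  IsComputablePoint wasserstein (idealMeasure s) μ

/-- Computable finite measures: the total mass is a computable real and, unless the measure is
zero, its normalization is a computable probability measure. -/
def IsComputableMeasure {X ι : Type*} [MetricSpace X] [CompactSpace X] [Nonempty X]
    [MeasurableSpace X] [BorelSpace X] [Primcodable ι] (s : ι → X) (μ : FiniteMeasure X) : Prop :=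
  IsComputableReal (μ.mass : ℝ) ∧ (μ ≠ 0 → IsComputableProbabilityMeasure s μ.normalize)

/-! ### The plane and the Mandelbrot set -/

/-- The ideal points of the plane: the points with rational coordinates. -/
def planePoint (p : RatCode × RatCode) : ℂ := ⟨(ratOf p.1 : ℝ), (ratOf p.2 : ℝ)⟩

/-- The square `[-2, 2] × [-2, 2]`, the compact space on which measures are considered. -/
def square : Set ℂ := Set.Icc (-2 : ℝ) 2 ×ℂ Set.Icc (-2 : ℝ) 2

instance : CompactSpace square :=
  isCompact_iff_compactSpace.mp (isCompact_Icc.reProdIm isCompact_Icc)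

instance : Nonempty square := ⟨⟨0, by simp [square, Complex.mem_reProdIm]⟩⟩

/-- Lebesgue measure on the square. -/
def squareVolume : Measure square := Measure.comap Subtype.val (volume : Measure ℂ)

theorem measurableSet_square : MeasurableSet square :=
  (isCompact_Icc.reProdIm isCompact_Icc).isClosed.measurableSet

instance : IsFiniteMeasure squareVolume :=
  ⟨by
    rw [squareVolume, comap_subtype_coe_apply measurableSet_square, Set.image_univ,
      Subtype.range_coe]
    exact (isCompact_Icc.reProdIm isCompact_Icc).measure_lt_top⟩

/-- The rational number nearest to `q` in `[-2, 2]`. -/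
def clamp (q : ℚ) : ℚ := max (-2) (min 2 q)

theorem clamp_mem (q : ℚ) : ((clamp q : ℚ) : ℝ) ∈ Set.Icc (-2 : ℝ) 2 := by
  have h1 : (-2 : ℚ) ≤ clamp q := le_max_left _ _
  have h2 : clamp q ≤ 2 := max_le (by norm_num) (min_le_left _ _)
  exact ⟨by exact_mod_cast h1, by exact_mod_cast h2⟩

/-- The ideal points of the square: its points with rational coordinates. -/
def squarePoint (p : RatCode × RatCode) : square :=
  ⟨⟨(clamp (ratOf p.1) : ℝ), (clamp (ratOf p.2) : ℝ)⟩,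
    Complex.mem_reProdIm.mpr ⟨clamp_mem _, clamp_mem _⟩⟩

/-- The Mandelbrot set: the parameters `c` for which the orbit of `0` under `z ↦ z ^ 2 + c` is
bounded. -/
def mandelbrot : Set ℂ :=
  {c | BddAbove (Set.range fun n : ℕ => ‖(fun z : ℂ => z ^ 2 + c)^[n] 0‖)}

/-- Lebesgue measure restricted to the Mandelbrot set, as a finite measure on the square (which
contains the Mandelbrot set). -/
def mandelbrotMeasure : FiniteMeasure square :=
  ⟨squareVolume.restrict (Subtype.val ⁻¹' mandelbrot), inferInstance⟩

end CompAnalysis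

end

/-! The set M := `mandelbrot` is the set of parameters whose critical orbit stays in the disc of
radius 2, so leaving this disc is a finite certificate of not being in M. With an explicit rational
error bound, one such certificate covers a whole ideal ball, and these balls exhaust the complement
(`isLowerComputableOpen_compl_mandelbrot`).

Deleting from finer and finer grids the cells certified to miss M leaves regions that contain M and
converge pointwise to it. Their rational areas bound the area of M from above and converge to it.
Deleting also the cells certified to lie in an ideal ball B does the same for M \ B
(`volume_real_diff_le_areaCode`, `tendsto_ratOf_areaCode`).

The analytic core is `volume_mandelbrot_inter_ball_pos`: every ball centred on M meets M in positive
area. Otherwise the ball contains no interior point of M, hence no parameter with periodic critical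
point, since such parameters are interior. Then u_n = 2^(-n) log |orbit c n| is harmonic on the ball
for n ≥ 1, with a uniform upper bound. A nearby parameter outside M gives a lower bound by Harnack,
so Fatou's lemma applies: almost everywhere the lower limit of u_n is positive, whereas its mean on
a smaller disc centred at c₀ ∈ M is u_n(c₀) ≤ 2^(-n) log 2, which tends to 0. This is a
contradiction, and it identifies the support of the restricted measure.

Consequently M meets B if and only if area(M \ B) < area(M). The left side is approximable from
above; if the right side is computable, the strict inequality is semi-decidable. Finally, the
uniform measure on the corners of the kept cells is W₁-close to normalized area on M, with an error
controlled by the mesh and the excess area. A computable area makes this error computably bounded,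
so a search finds a grid of any required precision. -/

namespace CompAnalysis

/-! ### Escape of the critical orbit and interior parameters. -/

/-- The critical orbit of `z ↦ z ^ 2 + c`. -/
def orbit (c : ℂ) (n : ℕ) : ℂ := (fun z : ℂ => z ^ 2 + c)^[n] 0

@[simp] theorem orbit_zero (c : ℂ) : orbit c 0 = 0 := rfl

theorem orbit_succ (c : ℂ) (n : ℕ) : orbit c (n + 1) = orbit c n ^ 2 + c :=
  Function.iterate_succ_apply' _ _ _

theorem continuous_orbit (n : ℕ) : Continuous fun c => orbit c n := by
  induction n with
  | zero => simpa using continuous_const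
  | succ n ih => simp only [orbit_succ]; fun_prop

theorem differentiable_orbit (n : ℕ) : Differentiable ℂ fun c => orbit c n := by
  induction n with
  | zero => simp
  | succ n ih => simp only [orbit_succ]; fun_prop

theorem mem_mandelbrot {c : ℂ} :
    c ∈ mandelbrot ↔ BddAbove (Set.range fun n : ℕ => ‖orbit c n‖) := Iff.rfl

/-- If |z| ≥ 2 and |c| ≤ |z|, then |z² + c| - 1 ≥ |z|² - |z| - 1 ≥ (|z| - 1)². Subtracting 1 thus
absorbs the parameter and leaves pure squaring. -/
theorem orbit_growth {c : ℂ} {m : ℕ} (h2 : 2 ≤ ‖orbit c m‖) (hc : ‖c‖ ≤ ‖orbit c m‖) (k : ℕ) :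
    (‖orbit c m‖ - 1) ^ 2 ^ k ≤ ‖orbit c (m + k)‖ - 1 ∧ ‖orbit c m‖ ≤ ‖orbit c (m + k)‖ := by
  induction k with
  | zero => simp
  | succ k ih =>
    obtain ⟨h, h'⟩ := ih
    have hn : ‖orbit c (m + k)‖ ^ 2 - ‖c‖ ≤ ‖orbit c (m + (k + 1))‖ := by
      rw [← add_assoc, orbit_succ, ← norm_pow]
      exact norm_sub_le_norm_add _ _
    have hp : (‖orbit c m‖ - 1) ^ 2 ^ (k + 1) ≤ (‖orbit c (m + k)‖ - 1) ^ 2 := by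
      rw [pow_succ, pow_mul]
      exact pow_le_pow_left₀ (pow_nonneg (by linarith) _) h 2
    constructor <;> nlinarith

theorem norm_orbit_le_two {c : ℂ} (hc : c ∈ mandelbrot) :
    ‖c‖ ≤ 2 ∧ ∀ n, ‖orbit c n‖ ≤ 2 := by
  have key : ∀ m, ‖c‖ ≤ ‖orbit c m‖ → ‖orbit c m‖ ≤ 2 := by
    intro m hm
    by_contra! h
    obtain ⟨B, hB⟩ := mem_mandelbrot.mp hc
    obtain ⟨k, hk⟩ := pow_unbounded_of_one_lt B (show 1 < ‖orbit c m‖ - 1 by linarith)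
    have h1 := (orbit_growth h.le hm k).1
    have h2 : ‖orbit c (m + k)‖ ≤ B := hB ⟨_, rfl⟩
    have h3 : (‖orbit c m‖ - 1) ^ k ≤ (‖orbit c m‖ - 1) ^ 2 ^ k :=
      pow_le_pow_right₀ (by linarith) k.lt_two_pow_self.le
    linarith
  have hc2 : ‖c‖ ≤ 2 := by
    have := key 1 (by simp [orbit_succ])
    simpa [orbit_succ] using this
  refine ⟨hc2, fun n => ?_⟩
  by_contra! h
  exact absurd (key n (by linarith)) (by linarith)

theorem mem_mandelbrot_iff_le_two {c : ℂ} : c ∈ mandelbrot ↔ ∀ n, ‖orbit c n‖ ≤ 2 :=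
  ⟨fun h => (norm_orbit_le_two h).2, fun h => mem_mandelbrot.mpr ⟨2, by rintro _ ⟨n, rfl⟩; exact h n⟩⟩

theorem isClosed_mandelbrot : IsClosed mandelbrot := by
  have : mandelbrot = ⋂ n, {c | ‖orbit c n‖ ≤ 2} := by
    ext c; simp [mem_mandelbrot_iff_le_two]
  rw [this]
  exact isClosed_iInter fun n => isClosed_le (continuous_orbit n).norm continuous_const

theorem mandelbrot_subset_closedBall : mandelbrot ⊆ Metric.closedBall 0 2 := fun c hc => by
  simpa using (norm_orbit_le_two hc).1

theorem mandelbrot_subset_square : mandelbrot ⊆ square := fun c hc => by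
  have h := (norm_orbit_le_two hc).1
  exact Complex.mem_reProdIm.mpr
    ⟨abs_le.mp ((Complex.abs_re_le_norm c).trans h), abs_le.mp ((Complex.abs_im_le_norm c).trans h)⟩

/-- A quantitative escape rate, standing in for positivity of the Green function outside M; no limit
of these quotients is needed. -/
theorem exists_pos_le_log_norm_orbit {c : ℂ} (hc : c ∉ mandelbrot) :
    ∃ a > 0, ∀ᶠ n in atTop, a ≤ Real.log ‖orbit c n‖ / 2 ^ n := by
  obtain ⟨m, hm⟩ : ∃ m, max 2 ‖c‖ < ‖orbit c m‖ := by
    by_contra! h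
    exact hc (mem_mandelbrot.mpr ⟨_, by rintro _ ⟨n, rfl⟩; exact h n⟩)
  have h2 : 2 < ‖orbit c m‖ := (le_max_left _ _).trans_lt hm
  have h3 : ‖c‖ < ‖orbit c m‖ := (le_max_right _ _).trans_lt hm
  refine ⟨Real.log (‖orbit c m‖ - 1) / 2 ^ m,
    div_pos (Real.log_pos (by linarith)) (by positivity), ?_⟩
  filter_upwards [eventually_ge_atTop m] with n hn
  obtain ⟨k, rfl⟩ := Nat.exists_eq_add_of_le hn
  have h := (orbit_growth h2.le h3.le k).1
  have hl : (2 : ℝ) ^ k * Real.log (‖orbit c m‖ - 1) ≤ Real.log ‖orbit c (m + k)‖ := by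
    have := Real.log_le_log (pow_pos (show 0 < ‖orbit c m‖ - 1 by linarith) (2 ^ k))
      (h.trans (sub_le_self _ zero_le_one))
    rw [Real.log_pow] at this
    simpa using this
  rw [pow_add, div_le_div_iff₀ (by positivity) (by positivity)]
  have : (0 : ℝ) < 2 ^ m := by positivity
  nlinarith

theorem norm_orbit_le_pow {c : ℂ} {R : ℝ} (hR : 2 ≤ R) (hc : ‖c‖ ≤ R) (n : ℕ) :
    ‖orbit c n‖ ≤ R ^ 2 ^ n := by
  -- The extra summand `R` makes the induction close: the cross term in (|z| + R)² pays for the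
  -- parameter, because R² ≥ 2R.
  suffices h : ‖orbit c n‖ + R ≤ R ^ 2 ^ n by linarith
  induction n with
  | zero => simp
  | succ n ih =>
    have h1 : ‖orbit c (n + 1)‖ ≤ ‖orbit c n‖ ^ 2 + ‖c‖ := by
      rw [orbit_succ, ← norm_pow]; exact norm_add_le _ _
    have h2 : (‖orbit c n‖ + R) ^ 2 ≤ R ^ 2 ^ (n + 1) := by
      rw [pow_succ 2, pow_mul]
      exact pow_le_pow_left₀ (by positivity) ih 2
    nlinarith [norm_nonneg (orbit c n)]

/-- Parameters with a periodic critical point are interior points of the Mandelbrot set. -/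
theorem mandelbrot_mem_nhds_of_orbit_eq_zero {c₀ : ℂ} {n : ℕ} (h0 : orbit c₀ (n + 1) = 0) :
    mandelbrot ∈ 𝓝 c₀ := by
  -- The return map is z ↦ `F c (z ^ 2 + c)`. At `c₀` it fixes 0 and is O(z²) there, so it contracts
  -- a small disc strictly into itself.
  set F : ℂ → ℂ → ℂ := fun c z => (fun z : ℂ => z ^ 2 + c)^[n] z with hF
  have hFc : Continuous fun p : ℂ × ℂ => F p.1 p.2 := by
    have : ∀ k, Continuous fun p : ℂ × ℂ => (fun z : ℂ => z ^ 2 + p.1)^[k] p.2 := by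
      intro k
      induction k with
      | zero => simpa using continuous_snd
      | succ k ih => simp only [Function.iterate_succ_apply']; fun_prop
    exact this n
  have hFd : Differentiable ℂ (F c₀) := Differentiable.iterate (by fun_prop) n
  have hF0 : F c₀ c₀ = 0 := by
    have : (fun z : ℂ => z ^ 2 + c₀)^[n + 1] 0 = 0 := h0
    rw [Function.iterate_succ_apply] at this
    simpa [hF] using this
  obtain ⟨K, hK⟩ := (hFd c₀).isBigO_sub.bound
  have hK' : ∀ᶠ w in 𝓝 (0 : ℂ), ‖F c₀ (w ^ 2 + c₀)‖ ≤ K * ‖w‖ ^ 2 := by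
    have ht : Tendsto (fun w : ℂ => w ^ 2 + c₀) (𝓝 0) (𝓝 c₀) := by
      have : Continuous fun w : ℂ => w ^ 2 + c₀ := by fun_prop
      simpa using this.tendsto 0
    filter_upwards [ht.eventually hK] with w hw
    simpa [hF0] using hw
  obtain ⟨ε₀, hε₀, hball⟩ := Metric.eventually_nhds_iff.mp hK'
  obtain ⟨ε, hε, hεle, hε1, hKε⟩ : ∃ ε > 0, ε < ε₀ ∧ ε ≤ 1 ∧ |K| * ε ≤ 1 / 2 := by
    refine ⟨min (ε₀ / 2) (min 1 (1 / (2 * (|K| + 1)))), by positivity, ?_, ?_, ?_⟩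
    · exact (min_le_left _ _).trans_lt (by linarith)
    · exact (min_le_right _ _).trans (min_le_left _ _)
    · have h1 : min (ε₀ / 2) (min 1 (1 / (2 * (|K| + 1)))) ≤ 1 / (2 * (|K| + 1)) :=
        (min_le_right _ _).trans (min_le_right _ _)
      refine (mul_le_mul_of_nonneg_left h1 (abs_nonneg K)).trans ?_
      rw [mul_one_div, div_le_div_iff₀ (by positivity) (by positivity)]
      linarith
  -- At `c₀` the disc goes into the disc of radius ε / 2; compactness leaves the other ε / 2 for the
  -- perturbation of the parameter.
  have hun : ∀ᶠ c in 𝓝 c₀, ∀ z ∈ Metric.closedBall (0 : ℂ) ε,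
      ‖F c (z ^ 2 + c) - F c₀ (z ^ 2 + c₀)‖ < ε / 2 := by
    have hc : Continuous fun p : ℂ × ℂ => ‖F p.1 (p.2 ^ 2 + p.1) - F c₀ (p.2 ^ 2 + c₀)‖ := by
      have h1 : Continuous fun p : ℂ × ℂ => F p.1 (p.2 ^ 2 + p.1) :=
        hFc.comp (g := fun p : ℂ × ℂ => F p.1 p.2) (f := fun p : ℂ × ℂ => (p.1, p.2 ^ 2 + p.1))
          (by fun_prop)
      have h2 : Continuous fun p : ℂ × ℂ => F c₀ (p.2 ^ 2 + c₀) :=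
        hFd.continuous.comp (by fun_prop)
      exact (h1.sub h2).norm
    refine (isCompact_closedBall (0 : ℂ) ε).eventually_forall_of_forall_eventually fun z _ => ?_
    exact (isOpen_lt hc continuous_const).mem_nhds (by simpa using half_pos hε)
  filter_upwards [hun] with c hc
  have hstep : ∀ z ∈ Metric.closedBall (0 : ℂ) ε,
      (fun z : ℂ => z ^ 2 + c)^[n + 1] z ∈ Metric.closedBall (0 : ℂ) ε := by
    intro z hz
    have hz' : ‖z‖ ≤ ε := by simpa using hz
    have h1 := hc z hz
    have h2 : ‖F c₀ (z ^ 2 + c₀)‖ ≤ K * ‖z‖ ^ 2 := hball (by simpa using hz'.trans_lt hεle)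
    have h3 : K * ‖z‖ ^ 2 ≤ ε / 2 := by
      calc K * ‖z‖ ^ 2 ≤ |K| * ε ^ 2 :=
            mul_le_mul (le_abs_self K) (pow_le_pow_left₀ (norm_nonneg _) hz' 2) (by positivity)
              (abs_nonneg K)
        _ = (|K| * ε) * ε := by ring
        _ ≤ 1 / 2 * ε := mul_le_mul_of_nonneg_right hKε hε.le
        _ = ε / 2 := by ring
    have h4 : ‖F c (z ^ 2 + c)‖ ≤ ε := by
      have := norm_le_norm_sub_add (F c (z ^ 2 + c)) (F c₀ (z ^ 2 + c₀))
      linarith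
    simpa [Function.iterate_succ_apply, hF] using h4
  have hret : ∀ k, ‖orbit c ((n + 1) * k)‖ ≤ ε := by
    intro k
    have : orbit c ((n + 1) * k) ∈ Metric.closedBall (0 : ℂ) ε := by
      unfold orbit
      rw [Function.iterate_mul]
      exact Set.MapsTo.iterate hstep k (by simpa using hε.le)
    simpa using this
  -- Outside M the logarithms are eventually positive at all times, contradicting the returns of
  -- modulus at most 1 at multiples of n + 1.
  by_contra hcM
  obtain ⟨a, ha, hev⟩ := exists_pos_le_log_norm_orbit hcM
  obtain ⟨N, hN⟩ := eventually_atTop.mp hev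
  have h1 := hN ((n + 1) * N) (by nlinarith [Nat.zero_le (n * N)])
  have h2 : Real.log ‖orbit c ((n + 1) * N)‖ ≤ 0 :=
    Real.log_nonpos (norm_nonneg _) ((hret N).trans hε1)
  have h3 : Real.log ‖orbit c ((n + 1) * N)‖ / 2 ^ ((n + 1) * N) ≤ 0 :=
    div_nonpos_of_nonpos_of_nonneg h2 (by positivity)
  linarith

/-! ### Potential theory: every ball centred on M meets M in positive area. -/

open InnerProductSpace in
/-- The mean value property of harmonic functions over discs. -/
theorem setIntegral_closedBall_of_harmonicOnNhd {f : ℂ → ℝ} {c : ℂ} {R : ℝ}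
    (hf : HarmonicOnNhd f (Metric.closedBall c R)) :
    ∫ z in Metric.closedBall c R, f z = volume.real (Metric.closedBall c R) * f c := by
  set B := Metric.closedBall (0 : ℂ) R with hB
  have htrans : ∫ z in Metric.closedBall c R, f z = ∫ z in B, f (c + z) := by
    have h := (measurePreserving_add_left (volume : Measure ℂ) c).setIntegral_preimage_emb
      (measurableEmbedding_addLeft c) f (Metric.closedBall c R)
    rw [← h]
    congr 2
    ext z; simp [hB]
  have hvol : volume.real (Metric.closedBall c R) = volume.real B := by
    simp only [hB, Measure.real, Complex.volume_closedBall]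
  -- Rotations preserve the disc integral. Averaging over θ and exchanging the integrals turns the
  -- integrand into circle averages, all equal to `f c`.
  have hrot : ∀ θ : ℝ, ∫ z in B, f (c + Circle.exp θ * z) = ∫ z in B, f (c + z) := by
    intro θ
    have h := (rotation (Circle.exp θ)).measurePreserving.setIntegral_preimage_emb
      (rotation (Circle.exp θ)).toHomeomorph.measurableEmbedding (fun z => f (c + z)) B
    rw [← h]
    congr 2
    ext z
    rw [hB, Set.mem_preimage, mem_closedBall_zero_iff, mem_closedBall_zero_iff,
      LinearIsometryEquiv.norm_map]
  have hmem : ∀ (θ : ℝ), ∀ z ∈ B, c + Circle.exp θ * z ∈ Metric.closedBall c R := by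
    intro θ z hz
    simpa [hB] using hz
  have hcirc : ∀ z ∈ B, ∫ θ in (0 : ℝ)..2 * Real.pi, f (c + Circle.exp θ * z)
      = 2 * Real.pi * f c := by
    intro z hz
    have hz' : ‖z‖ ≤ R := by simpa [hB] using hz
    have h := InnerProductSpace.HarmonicOnNhd.circleAverage_eq (f := f) (c := c) (R := ‖z‖)
      (hf.mono (Metric.closedBall_subset_closedBall (by simpa using hz')))
    -- Starting the circle at the argument of `z` makes its points exactly c + exp(iθ) z.
    rw [Real.circleAverage_eq_integral_add z.arg, smul_eq_mul, inv_mul_eq_iff_eq_mul₀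
      (by positivity)] at h
    rw [← h]
    congr 1
    ext θ
    congr 1
    rw [circleMap]
    congr 1
    push_cast
    rw [add_mul, Complex.exp_add]
    conv_lhs => rw [← Complex.norm_mul_exp_arg_mul_I z]
    ring
  have hint : Integrable (Function.uncurry fun (θ : ℝ) (z : ℂ) => f (c + Circle.exp θ * z))
      ((volume.restrict (Set.uIoc 0 (2 * Real.pi))).prod (volume.restrict B)) := by
    rw [Measure.prod_restrict]
    have hK : IntegrableOn (Function.uncurry fun (θ : ℝ) (z : ℂ) => f (c + Circle.exp θ * z))
        (Set.Icc 0 (2 * Real.pi) ×ˢ B) (volume.prod volume) := by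
      apply ContinuousOn.integrableOn_compact (isCompact_Icc.prod (isCompact_closedBall _ _))
      apply hf.continuousOn.comp (f := fun p : ℝ × ℂ => c + Circle.exp p.1 * p.2)
      · have : Continuous fun p : ℝ × ℂ => c + (Circle.exp p.1 : ℂ) * p.2 := by fun_prop
        exact this.continuousOn
      · rintro ⟨θ, z⟩ ⟨-, hz⟩
        exact hmem θ z hz
    refine hK.mono_set (Set.prod_mono ?_ le_rfl)
    rw [Set.uIoc_of_le (by positivity)]
    exact Set.Ioc_subset_Icc_self
  have hswap := intervalIntegral_integral_swap hint
  rw [setIntegral_congr_fun measurableSet_closedBall hcirc] at hswap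
  simp only [hrot, intervalIntegral.integral_const, setIntegral_const, smul_eq_mul, sub_zero]
    at hswap
  rw [htrans, hvol]
  have hpi : (2 * Real.pi) ≠ 0 := by positivity
  apply mul_left_cancel₀ hpi
  rw [hswap]; ring

theorem volume_real_closedBall (c : ℂ) {R : ℝ} (hR : 0 ≤ R) :
    volume.real (Metric.closedBall c R) = Real.pi * R ^ 2 := by
  simp [Measure.real, Complex.volume_closedBall, ENNReal.toReal_ofReal hR, mul_comm]

open InnerProductSpace in
/-- A Harnack inequality. -/
theorem harnack {f : ℂ → ℝ} {c x : ℂ} {s : ℝ} (hs : 0 < s)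
    (hf : HarmonicOnNhd f (Metric.closedBall c (4 * s)))
    (h0 : ∀ z ∈ Metric.closedBall c (4 * s), 0 ≤ f z) (hx : dist x c ≤ 3 * s) :
    f x ≤ 16 * f c := by
  have hsub : Metric.closedBall x s ⊆ Metric.closedBall c (4 * s) :=
    Metric.closedBall_subset_closedBall' (by linarith)
  have h1 := setIntegral_closedBall_of_harmonicOnNhd hf
  have h2 := setIntegral_closedBall_of_harmonicOnNhd (hf.mono hsub)
  -- Positivity lets the integral grow from the small disc to the large one; 16 is the ratio of
  -- their areas.
  have h3 : ∫ z in Metric.closedBall x s, f z ≤ ∫ z in Metric.closedBall c (4 * s), f z := by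
    apply setIntegral_mono_set
    · exact hf.continuousOn.integrableOn_compact (isCompact_closedBall _ _)
    · exact (ae_restrict_iff' measurableSet_closedBall).mpr (ae_of_all _ h0)
    · exact hsub.eventuallyLE
  rw [h1, h2, volume_real_closedBall _ hs.le, volume_real_closedBall _ (by positivity)] at h3
  have : 0 < Real.pi * s ^ 2 := by positivity
  have h4 : Real.pi * s ^ 2 * f x ≤ Real.pi * s ^ 2 * (16 * f c) := by
    refine h3.trans (le_of_eq ?_); ring
  exact le_of_mul_le_mul_left h4 this

theorem volume_mandelbrot_inter_ball_pos {c₀ : ℂ} (hc₀ : c₀ ∈ mandelbrot) {R : ℝ} (hR : 0 < R) :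
    0 < volume (mandelbrot ∩ Metric.ball c₀ R) := by
  rw [pos_iff_ne_zero]
  intro hnull
  have hout : ∀ U ⊆ Metric.ball c₀ R, IsOpen U → U.Nonempty → ∃ c ∈ U, c ∉ mandelbrot := by
    intro U hU hUo hUn
    by_contra! h
    exact (hUo.measure_pos volume hUn).ne'
      (measure_mono_null (show U ⊆ mandelbrot ∩ Metric.ball c₀ R from fun c hc => ⟨h c hc, hU hc⟩) hnull)
  have hzero : ∀ c ∈ Metric.ball c₀ R, ∀ n, orbit c (n + 1) ≠ 0 := by
    intro c hc n h
    have h1 := mandelbrot_mem_nhds_of_orbit_eq_zero h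
    obtain ⟨d, hd, hd'⟩ := hout (interior mandelbrot ∩ Metric.ball c₀ R) Set.inter_subset_right
      (isOpen_interior.inter Metric.isOpen_ball) ⟨c, mem_interior_iff_mem_nhds.mpr h1, hc⟩
    exact hd' (interior_subset hd.1)
  obtain ⟨c₁, hc₁, hc₁M⟩ := hout (Metric.ball c₀ (R / 4))
    (Metric.ball_subset_ball (by linarith)) Metric.isOpen_ball ⟨c₀, by simpa using hR⟩
  have hc₁' : dist c₁ c₀ < R / 4 := hc₁
  -- With `c₁` within 2s of `c₀`, the disc of radius 4s about `c₁` stays in the ball, and every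
  -- point within s of `c₀` is within 3s of `c₁`, as `harnack` requires.
  set s := R / 8 with hs
  have hs0 : 0 < s := by positivity
  have hsub : Metric.closedBall c₁ (4 * s) ⊆ Metric.ball c₀ R := by
    intro z hz
    have h1 : dist z c₁ ≤ 4 * s := hz
    have h2 := dist_triangle z c₁ c₀
    rw [Metric.mem_ball]
    linarith
  set ρ : ℝ := ‖c₀‖ + R + 2 with hρ
  set C := Real.log ρ with hC
  have hC0 : 0 ≤ C := Real.log_nonneg (by have := norm_nonneg c₀; linarith)
  set u : ℕ → ℂ → ℝ := fun n c => Real.log ‖orbit c (n + 1)‖ / 2 ^ (n + 1) with hu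
  have hup : ∀ n, ∀ c ∈ Metric.ball c₀ R, Real.log ‖orbit c (n + 1)‖ ≤ 2 ^ (n + 1) * C := by
    intro n c hc
    have hcρ : ‖c‖ ≤ ρ := by
      have h1 : ‖c - c₀‖ < R := by simpa [dist_eq_norm] using hc
      have h2 := norm_le_norm_sub_add c c₀
      linarith
    have h := norm_orbit_le_pow (show 2 ≤ ρ by have := norm_nonneg c₀; linarith) hcρ (n + 1)
    have h' := Real.log_le_log (norm_pos_iff.mpr (hzero c hc n)) h
    rw [Real.log_pow] at h'
    simpa using h'
  obtain ⟨a, ha, hev⟩ := exists_pos_le_log_norm_orbit hc₁M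
  -- Harnack at `c₁` for 2^(n+1) C - log |orbit|, which is nonnegative by `hup`. Its value at `c₁`
  -- is at most 2^(n+1) C, so its values near `c₀` are at most 16 times that; this gives the
  -- constant 15 C.
  have hlow : ∀ᶠ n in atTop, ∀ x ∈ Metric.closedBall c₀ s, 0 ≤ u n x + 15 * C := by
    filter_upwards [(tendsto_add_atTop_nat 1).eventually hev] with n hn x hx
    have h1 : 0 ≤ Real.log ‖orbit c₁ (n + 1)‖ := by
      by_contra! h
      have := div_neg_of_neg_of_pos h (show (0 : ℝ) < 2 ^ (n + 1) by positivity)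
      linarith
    have hx' : dist x c₀ ≤ s := hx
    have h2 := harnack (f := (fun _ => 2 ^ (n + 1) * C) - fun c => Real.log ‖orbit c (n + 1)‖)
      (c := c₁) (x := x) hs0
      (by
        refine fun z hz => InnerProductSpace.HarmonicAt.sub ?_ ?_
        · exact InnerProductSpace.harmonicAt_const _
        · exact ((differentiable_orbit (n + 1)).analyticAt z).harmonicAt_log_norm
            (hzero z (hsub hz) n))
      (fun z hz => by
        have := hup n z (hsub hz)
        simp only [Pi.sub_apply]; linarith)
      (by
        have := dist_triangle x c₀ c₁
        rw [dist_comm c₀ c₁] at this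
        linarith)
    simp only [Pi.sub_apply] at h2
    have h3 : 0 ≤ Real.log ‖orbit x (n + 1)‖ + 15 * C * 2 ^ (n + 1) := by linarith
    have h4 : u n x + 15 * C = (Real.log ‖orbit x (n + 1)‖ + 15 * C * 2 ^ (n + 1)) / 2 ^ (n + 1) := by
      rw [hu]; field_simp
    rw [h4]; positivity
  have hs_sub : Metric.closedBall c₀ s ⊆ Metric.ball c₀ R :=
    Metric.closedBall_subset_ball (by linarith)
  set μ := (volume : Measure ℂ).restrict (Metric.closedBall c₀ s) with hμ
  have hμuniv : μ Set.univ = volume (Metric.closedBall c₀ s) := by simp [hμ]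
  have : IsFiniteMeasure μ := ⟨by rw [hμuniv]; exact measure_closedBall_lt_top⟩
  have hmeas : ∀ n, Measurable fun x => ENNReal.ofReal (u n x + 15 * C) := fun n =>
    ENNReal.measurable_ofReal.comp
      (((Real.measurable_log.comp (continuous_orbit (n + 1)).norm.measurable).div_const _).add_const _)
  have hfatou := lintegral_liminf_le (μ := μ) (u := atTop) hmeas
  -- Strict because almost every point of the disc lies outside M and so has a positive escape rate.
  have hleft : ∫⁻ _, ENNReal.ofReal (15 * C) ∂μ
      < ∫⁻ x, liminf (fun n => ENNReal.ofReal (u n x + 15 * C)) atTop ∂μ := by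
    apply lintegral_strict_mono
    · rw [Ne, ← Measure.measure_univ_eq_zero, hμuniv]
      exact (Metric.measure_closedBall_pos _ _ hs0).ne'
    · exact (Measurable.liminf hmeas).aemeasurable
    · rw [lintegral_const, hμuniv]
      exact ENNReal.mul_ne_top ENNReal.ofReal_ne_top measure_closedBall_lt_top.ne
    · rw [hμ, ae_restrict_iff' measurableSet_closedBall]
      have hae : ∀ᵐ x : ℂ, x ∉ mandelbrot ∩ Metric.ball c₀ R := measure_eq_zero_iff_ae_notMem.mp hnull
      filter_upwards [hae] with x hx hxs
      obtain ⟨b, hb, hbe⟩ := exists_pos_le_log_norm_orbit fun h => hx ⟨h, hs_sub hxs⟩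
      calc ENNReal.ofReal (15 * C) < ENNReal.ofReal (b + 15 * C) :=
            (ENNReal.ofReal_lt_ofReal_iff (by positivity)).mpr (by linarith)
        _ ≤ _ := by
            refine le_liminf_of_le (by isBoundedDefault) ?_
            filter_upwards [(tendsto_add_atTop_nat 1).eventually hbe] with n hn
            exact ENNReal.ofReal_le_ofReal (by simpa [hu] using hn)
  -- The mean value property evaluates the integral at `c₀`, whose orbit never exceeds 2.
  have hright : ∀ᶠ n in atTop, ∫⁻ x, ENNReal.ofReal (u n x + 15 * C) ∂μ
      ≤ ENNReal.ofReal (volume.real (Metric.closedBall c₀ s) * (Real.log 2 / 2 ^ (n + 1) + 15 * C)) := by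
    filter_upwards [hlow] with n hn
    have hharm : InnerProductSpace.HarmonicOnNhd (fun c => Real.log ‖orbit c (n + 1)‖)
        (Metric.closedBall c₀ s) := fun z hz =>
      ((differentiable_orbit (n + 1)).analyticAt z).harmonicAt_log_norm (hzero z (hs_sub hz) n)
    have hint : Integrable (fun c => Real.log ‖orbit c (n + 1)‖) μ :=
      hharm.continuousOn.integrableOn_compact (isCompact_closedBall _ _)
    have hint' : Integrable (fun x => u n x + 15 * C) μ :=
      (hint.div_const _).add (integrable_const _)
    rw [← ofReal_integral_eq_lintegral_ofReal hint'
      ((ae_restrict_iff' measurableSet_closedBall).mpr (ae_of_all _ hn))]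
    apply ENNReal.ofReal_le_ofReal
    rw [integral_add (hint.div_const _) (integrable_const _), integral_div,
      setIntegral_closedBall_of_harmonicOnNhd hharm, integral_const, smul_eq_mul, mul_add,
      mul_div_assoc]
    have hlog : Real.log ‖orbit c₀ (n + 1)‖ ≤ Real.log 2 :=
      Real.log_le_log (norm_pos_iff.mpr (hzero c₀ (Metric.mem_ball_self hR) n))
        ((norm_orbit_le_two hc₀).2 _)
    have : (0:ℝ) ≤ (volume (Metric.closedBall c₀ s)).toReal := ENNReal.toReal_nonneg
    simp only [measureReal_def, hμuniv]
    gcongr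
  have hlim : Tendsto (fun n : ℕ => ENNReal.ofReal
      (volume.real (Metric.closedBall c₀ s) * (Real.log 2 / 2 ^ (n + 1) + 15 * C))) atTop
      (𝓝 (ENNReal.ofReal (volume.real (Metric.closedBall c₀ s) * (0 + 15 * C)))) := by
    refine ENNReal.tendsto_ofReal ((Tendsto.add_const _ ?_).const_mul _)
    have h := (tendsto_pow_atTop_nhds_zero_of_lt_one (r := (1 / 2 : ℝ)) (by norm_num)
      (by norm_num)).const_mul (Real.log 2)
    have h' := (tendsto_add_atTop_iff_nat 1).mpr h
    simpa [div_eq_mul_inv] using h'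
  have hle := (hfatou.trans (liminf_le_liminf hright)).trans_eq hlim.liminf_eq
  refine absurd (hleft.trans_le hle) (not_lt.mpr (le_of_eq ?_))
  rw [lintegral_const, hμuniv, zero_add, mul_comm, ENNReal.ofReal_mul (by positivity),
    Measure.real, ENNReal.ofReal_toReal measure_closedBall_lt_top.ne, mul_comm]

theorem support_restrict_mandelbrot : (volume.restrict mandelbrot).support = mandelbrot := by
  ext c
  rw [Metric.nhds_basis_ball.mem_measureSupport]
  constructor
  · intro h
    by_contra hc
    obtain ⟨ε, hε, hb⟩ := Metric.isOpen_iff.mp isClosed_mandelbrot.isOpen_compl c hc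
    refine (h ε hε).ne' ?_
    rw [Measure.restrict_apply Metric.isOpen_ball.measurableSet,
      Set.disjoint_iff_inter_eq_empty.mp (Set.disjoint_left.mpr fun x hx => hb hx), measure_empty]
  · intro hc ε hε
    rw [Measure.restrict_apply Metric.isOpen_ball.measurableSet, Set.inter_comm]
    exact volume_mandelbrot_inter_ball_pos hc hε

/-! ### Arithmetic of codes -/

/-- Addition of codes. -/
def addCode (p q : RatCode) : RatCode :=
  (p.1 * (q.2.2 + 1) + q.1 * (p.2.2 + 1), p.2.1 * (q.2.2 + 1) + q.2.1 * (p.2.2 + 1),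
    -- Denominators are stored minus one: this is (d + 1)(e + 1) - 1.
    p.2.2 * q.2.2 + p.2.2 + q.2.2)

/-- Multiplication of codes. -/
def mulCode (p q : RatCode) : RatCode :=
  (p.1 * q.1 + p.2.1 * q.2.1, p.1 * q.2.1 + p.2.1 * q.1, p.2.2 * q.2.2 + p.2.2 + q.2.2)

/-- Negation of codes. -/
def negCode (p : RatCode) : RatCode := (p.2.1, p.1, p.2.2)

/-- Comparison of codes. -/
def ltCode (p q : RatCode) : Bool :=
  decide (p.1 * (q.2.2 + 1) + q.2.1 * (p.2.2 + 1) < q.1 * (p.2.2 + 1) + p.2.1 * (q.2.2 + 1))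

/-- The code of a natural number. -/
def natCode (n : ℕ) : RatCode := (n, 0, 0)

@[simp] theorem ratOf_addCode (p q : RatCode) : ratOf (addCode p q) = ratOf p + ratOf q := by
  simp only [ratOf, addCode]; push_cast
  have h1 : (p.2.2 : ℚ) + 1 ≠ 0 := by positivity
  have h2 : (q.2.2 : ℚ) + 1 ≠ 0 := by positivity
  have h3 : (p.2.2 : ℚ) * q.2.2 + p.2.2 + q.2.2 + 1 ≠ 0 := by positivity
  rw [div_add_div _ _ h1 h2, div_eq_div_iff h3 (mul_ne_zero h1 h2)]
  ring

@[simp] theorem ratOf_mulCode (p q : RatCode) : ratOf (mulCode p q) = ratOf p * ratOf q := by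
  simp only [ratOf, mulCode]; push_cast
  have h1 : (p.2.2 : ℚ) + 1 ≠ 0 := by positivity
  have h2 : (q.2.2 : ℚ) + 1 ≠ 0 := by positivity
  have h3 : (p.2.2 : ℚ) * q.2.2 + p.2.2 + q.2.2 + 1 ≠ 0 := by positivity
  rw [div_mul_div_comm, div_eq_div_iff h3 (mul_ne_zero h1 h2)]
  ring

@[simp] theorem ratOf_negCode (p : RatCode) : ratOf (negCode p) = -ratOf p := by
  simp only [ratOf, negCode, ← neg_div, neg_sub]

@[simp] theorem ratOf_natCode (n : ℕ) : ratOf (natCode n) = n := by simp [ratOf, natCode]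

theorem ltCode_iff {p q : RatCode} : ltCode p q = true ↔ ratOf p < ratOf q := by
  have h1 : (0 : ℚ) < (p.2.2 : ℚ) + 1 := by positivity
  have h2 : (0 : ℚ) < (q.2.2 : ℚ) + 1 := by positivity
  rw [ltCode, decide_eq_true_iff, ← @Nat.cast_lt ℚ, ratOf, ratOf, div_lt_div_iff₀ h1 h2]
  push_cast
  constructor <;> intro h <;> linarith

theorem ratOf_surjective : Function.Surjective ratOf := fun q => by
  refine ⟨(q.num.toNat, (-q.num).toNat, q.den - 1), ?_⟩
  have hd : ((q.den - 1 : ℕ) : ℚ) + 1 = q.den := by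
    have := q.den_pos
    rw [← Nat.cast_succ, Nat.succ_eq_add_one, Nat.sub_add_cancel this]
  have hn : ((q.num.toNat : ℚ)) - ((-q.num).toNat : ℚ) = q.num := by
    have : ((q.num.toNat : ℤ)) - ((-q.num).toNat : ℤ) = q.num := by omega
    exact_mod_cast congrArg (Int.cast : ℤ → ℚ) this
  simp only [ratOf, hd, hn]
  exact Rat.num_div_den q

section

open Primrec

theorem primrec_addCode : Primrec₂ addCode := by
  have a : Primrec fun r : RatCode × RatCode => r.1.1 := fst.comp fst
  have b : Primrec fun r : RatCode × RatCode => r.1.2.1 := fst.comp (snd.comp fst)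
  have d : Primrec fun r : RatCode × RatCode => r.1.2.2 := snd.comp (snd.comp fst)
  have a' : Primrec fun r : RatCode × RatCode => r.2.1 := fst.comp snd
  have b' : Primrec fun r : RatCode × RatCode => r.2.2.1 := fst.comp (snd.comp snd)
  have d' : Primrec fun r : RatCode × RatCode => r.2.2.2 := snd.comp (snd.comp snd)
  exact (nat_add.comp (nat_mul.comp a (succ.comp d')) (nat_mul.comp a' (succ.comp d))).pair
    ((nat_add.comp (nat_mul.comp b (succ.comp d')) (nat_mul.comp b' (succ.comp d))).pair
      (nat_add.comp (nat_add.comp (nat_mul.comp d d') d) d'))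

theorem primrec_mulCode : Primrec₂ mulCode := by
  have a : Primrec fun r : RatCode × RatCode => r.1.1 := fst.comp fst
  have b : Primrec fun r : RatCode × RatCode => r.1.2.1 := fst.comp (snd.comp fst)
  have d : Primrec fun r : RatCode × RatCode => r.1.2.2 := snd.comp (snd.comp fst)
  have a' : Primrec fun r : RatCode × RatCode => r.2.1 := fst.comp snd
  have b' : Primrec fun r : RatCode × RatCode => r.2.2.1 := fst.comp (snd.comp snd)
  have d' : Primrec fun r : RatCode × RatCode => r.2.2.2 := snd.comp (snd.comp snd)
  exact (nat_add.comp (nat_mul.comp a a') (nat_mul.comp b b')).pair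
    ((nat_add.comp (nat_mul.comp a b') (nat_mul.comp b a')).pair
      (nat_add.comp (nat_add.comp (nat_mul.comp d d') d) d'))

theorem primrec_negCode : Primrec negCode :=
  (fst.comp snd).pair (fst.pair (snd.comp snd))

theorem primrec_ltCode : Primrec₂ ltCode := by
  have a : Primrec fun r : RatCode × RatCode => r.1.1 := fst.comp fst
  have b : Primrec fun r : RatCode × RatCode => r.1.2.1 := fst.comp (snd.comp fst)
  have d : Primrec fun r : RatCode × RatCode => r.1.2.2 := snd.comp (snd.comp fst)
  have a' : Primrec fun r : RatCode × RatCode => r.2.1 := fst.comp snd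
  have b' : Primrec fun r : RatCode × RatCode => r.2.2.1 := fst.comp (snd.comp snd)
  have d' : Primrec fun r : RatCode × RatCode => r.2.2.2 := snd.comp (snd.comp snd)
  exact (nat_lt.comp
    (nat_add.comp (nat_mul.comp a (succ.comp d')) (nat_mul.comp b' (succ.comp d)))
    (nat_add.comp (nat_mul.comp a' (succ.comp d)) (nat_mul.comp b (succ.comp d')))).decide

end

/-! ### A rigorous escape test -/

/-- A bound for the distance between the `n`-th points of the critical orbits of `s` and of the
parameters at distance at most `ρ` from `s`. -/
noncomputable def orbitError (s : ℂ) (ρ : ℝ) : ℕ → ℝ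
  | 0 => 0
  -- The factor 2 (1 + |z|²) replaces the sharper 2 |z| because it is rational at rational points,
  -- with no square root.
  | n + 1 => orbitError s ρ n * (2 * (1 + ‖orbit s n‖ ^ 2) + orbitError s ρ n) + ρ

theorem orbitError_nonneg (s : ℂ) {ρ : ℝ} (hρ : 0 ≤ ρ) (n : ℕ) : 0 ≤ orbitError s ρ n := by
  induction n with
  | zero => exact le_rfl
  | succ n ih => rw [orbitError]; positivity

theorem norm_orbit_sub_le {c s : ℂ} {ρ : ℝ} (h : ‖c - s‖ ≤ ρ) (n : ℕ) :
    ‖orbit c n - orbit s n‖ ≤ orbitError s ρ n := by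
  induction n with
  | zero => simp [orbitError]
  | succ n ih =>
    have h1 : orbit c (n + 1) - orbit s (n + 1) =
        (orbit c n - orbit s n) * (2 * orbit s n + (orbit c n - orbit s n)) + (c - s) := by
      simp only [orbit_succ]; ring
    have h2 : ‖2 * orbit s n + (orbit c n - orbit s n)‖ ≤
        2 * (1 + ‖orbit s n‖ ^ 2) + orbitError s ρ n := by
      refine (norm_add_le _ _).trans (add_le_add ?_ ih)
      rw [norm_mul, Complex.norm_ofNat]
      nlinarith [sq_nonneg (‖orbit s n‖ - 1)]
    rw [h1, orbitError]
    refine (norm_add_le _ _).trans (add_le_add ?_ h)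
    rw [norm_mul]
    exact mul_le_mul ih h2 (norm_nonneg _) ((norm_nonneg _).trans ih)

theorem continuous_orbitError (n : ℕ) : Continuous fun p : ℂ × ℝ => orbitError p.1 p.2 n := by
  induction n with
  | zero => exact continuous_const
  | succ n ih =>
    have := (continuous_orbit n).comp (continuous_fst (X := ℂ) (Y := ℝ))
    simp only [Function.comp_def] at this
    simp only [orbitError]
    fun_prop

theorem orbitError_zero_right (s : ℂ) (n : ℕ) : orbitError s 0 n = 0 := by
  induction n with
  | zero => rfl
  | succ n ih => simp [orbitError, ih]

/-- The orbits of all parameters at distance at most `ρ` from `s` have escaped at time `n`. -/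
def Escapes (s : ℂ) (ρ : ℝ) (n : ℕ) : Prop := 2 + orbitError s ρ n < ‖orbit s n‖

theorem Escapes.notMem_mandelbrot {c s : ℂ} {ρ : ℝ} {n : ℕ} (h : Escapes s ρ n)
    (hc : ‖c - s‖ ≤ ρ) : c ∉ mandelbrot := fun hM => by
  have h1 := (norm_orbit_le_two hM).2 n
  have h2 := norm_orbit_sub_le hc n
  have h3 := norm_le_norm_sub_add (orbit s n) (orbit c n)
  rw [norm_sub_rev] at h3
  unfold Escapes at h
  linarith

/-- At radius 0 the error bound vanishes and the test reads 2 < |orbit c n|, an open condition in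
centre and radius. -/
theorem exists_eventually_escapes {c : ℂ} (hc : c ∉ mandelbrot) :
    ∃ n, ∀ᶠ p : ℂ × ℝ in 𝓝 (c, 0), Escapes p.1 p.2 n := by
  obtain ⟨n, hn⟩ : ∃ n, 2 < ‖orbit c n‖ := by
    by_contra! h
    exact hc (mem_mandelbrot_iff_le_two.mpr h)
  refine ⟨n, (isOpen_lt (continuous_const.add (continuous_orbitError n))
    ((continuous_orbit n).comp continuous_fst).norm).mem_nhds ?_⟩
  simpa [orbitError_zero_right] using hn

/-- One step of the computation of the orbit of `s` and of the error bound for radius `ρ`. -/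
def orbitStep (a : (RatCode × RatCode) × RatCode) (q : (RatCode × RatCode) × RatCode) :
    (RatCode × RatCode) × RatCode :=
  ((addCode (addCode (mulCode q.1.1 q.1.1) (negCode (mulCode q.1.2 q.1.2))) a.1.1,
    addCode (mulCode (natCode 2) (mulCode q.1.1 q.1.2)) a.1.2),
    addCode (mulCode q.2 (addCode (mulCode (natCode 2) (addCode (natCode 1)
      (addCode (mulCode q.1.1 q.1.1) (mulCode q.1.2 q.1.2)))) q.2)) a.2)

/-- The codes of the `n`-th point of the orbit and of the error bound. -/
def orbitCode (a : (RatCode × RatCode) × RatCode) (n : ℕ) : (RatCode × RatCode) × RatCode :=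
  (orbitStep a)^[n] ((natCode 0, natCode 0), natCode 0)

/-- The escape test on codes. -/
def escapeTest (a : (RatCode × RatCode) × RatCode) (n : ℕ) : Bool :=
  ltCode (mulCode (addCode (natCode 2) (orbitCode a n).2) (addCode (natCode 2) (orbitCode a n).2))
    (addCode (mulCode (orbitCode a n).1.1 (orbitCode a n).1.1)
      (mulCode (orbitCode a n).1.2 (orbitCode a n).1.2))

theorem norm_planePoint_sq (p : RatCode × RatCode) :
    ‖planePoint p‖ ^ 2 = ((ratOf p.1 * ratOf p.1 + ratOf p.2 * ratOf p.2 : ℚ) : ℝ) := by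
  rw [← Complex.normSq_eq_norm_sq, Complex.normSq_apply]
  simp [planePoint]

theorem orbitCode_spec (a : (RatCode × RatCode) × RatCode) (n : ℕ) :
    planePoint (orbitCode a n).1 = orbit (planePoint a.1) n ∧
      (ratOf (orbitCode a n).2 : ℝ) = orbitError (planePoint a.1) (ratOf a.2) n := by
  induction n with
  | zero => constructor <;> simp [orbitCode, planePoint, orbitError]; rfl
  | succ n ih =>
    obtain ⟨h1, h2⟩ := ih
    have hs : orbitCode a (n + 1) = orbitStep a (orbitCode a n) :=
      Function.iterate_succ_apply' _ _ _
    constructor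
    · rw [hs, orbit_succ, ← h1]
      apply Complex.ext <;> simp [orbitStep, planePoint, sq] <;> ring
    · rw [hs, orbitError, ← h1, ← h2, norm_planePoint_sq]
      simp [orbitStep]

theorem escapeTest_iff {a : (RatCode × RatCode) × RatCode} (ha : 0 ≤ ratOf a.2) {n : ℕ} :
    escapeTest a n = true ↔ Escapes (planePoint a.1) (ratOf a.2) n := by
  obtain ⟨h1, h2⟩ := orbitCode_spec a n
  have h0 := orbitError_nonneg (planePoint a.1) (ρ := ratOf a.2) (by exact_mod_cast ha) n
  -- Both sides are nonnegative, so squaring reduces the test to a comparison of rationals.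
  rw [Escapes, ← pow_lt_pow_iff_left₀ (by linarith) (norm_nonneg _) two_ne_zero, ← h1, ← h2,
    norm_planePoint_sq, escapeTest, ltCode_iff, ← Rat.cast_lt (K := ℝ)]
  simp [sq]

section

open Primrec

theorem primrec_orbitStep : Primrec₂ orbitStep := by
  have sx : Primrec fun r : ((RatCode × RatCode) × RatCode) × ((RatCode × RatCode) × RatCode) =>
    r.1.1.1 := fst.comp (fst.comp fst)
  have sy : Primrec fun r : ((RatCode × RatCode) × RatCode) × ((RatCode × RatCode) × RatCode) =>
    r.1.1.2 := snd.comp (fst.comp fst)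
  have ρ : Primrec fun r : ((RatCode × RatCode) × RatCode) × ((RatCode × RatCode) × RatCode) =>
    r.1.2 := snd.comp fst
  have x : Primrec fun r : ((RatCode × RatCode) × RatCode) × ((RatCode × RatCode) × RatCode) =>
    r.2.1.1 := fst.comp (fst.comp snd)
  have y : Primrec fun r : ((RatCode × RatCode) × RatCode) × ((RatCode × RatCode) × RatCode) =>
    r.2.1.2 := snd.comp (fst.comp snd)
  have e : Primrec fun r : ((RatCode × RatCode) × RatCode) × ((RatCode × RatCode) × RatCode) =>
    r.2.2 := snd.comp snd
  exact ((primrec_addCode.comp (primrec_addCode.comp (primrec_mulCode.comp x x)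
      (primrec_negCode.comp (primrec_mulCode.comp y y))) sx).pair
    (primrec_addCode.comp (primrec_mulCode.comp (const _) (primrec_mulCode.comp x y)) sy)).pair
    (primrec_addCode.comp (primrec_mulCode.comp e (primrec_addCode.comp (primrec_mulCode.comp
      (const _) (primrec_addCode.comp (const _) (primrec_addCode.comp (primrec_mulCode.comp x x)
        (primrec_mulCode.comp y y)))) e)) ρ)

theorem primrec_orbitCode : Primrec₂ orbitCode :=
  nat_iterate snd (const _) (primrec_orbitStep.comp (fst.comp fst) snd)

theorem primrec_escapeTest : Primrec₂ escapeTest := by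
  have e := primrec_addCode.comp (const (natCode 2)) (snd.comp primrec_orbitCode)
  have x := fst.comp (fst.comp primrec_orbitCode)
  have y := snd.comp (fst.comp primrec_orbitCode)
  exact primrec_ltCode.comp (primrec_mulCode.comp e e)
    (primrec_addCode.comp (primrec_mulCode.comp x x) (primrec_mulCode.comp y y))

/-- Semi-decidable sets with a known element are ranges of computable sequences. -/
theorem exists_computable_range {α : Type*} [Primcodable α] {p : α → ℕ → Bool} (hp : Primrec₂ p)
    {a₀ : α} {n₀ : ℕ} (h₀ : p a₀ n₀ = true) :
    ∃ f : ℕ → α, Computable f ∧ ∀ a, (∃ k, f k = a) ↔ ∃ n, p a n = true := by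
  -- Every natural number is read as a pair (candidate, time); the default `a₀` is output when
  -- decoding or the test fails, which keeps the sequence total.
  refine ⟨fun k => ((Encodable.decode (α := α × ℕ) k).bind fun q =>
    bif p q.1 q.2 then some q.1 else none).getD a₀, Primrec.to_comp ?_, fun a => ⟨?_, ?_⟩⟩
  · exact option_getD.comp (option_bind Primrec.decode (Primrec.cond
      (hp.comp (fst.comp snd) (snd.comp snd)) (option_some.comp (fst.comp snd)) (const _)))
      (const _)
  · rintro ⟨k, rfl⟩
    rcases h : Encodable.decode (α := α × ℕ) k with _ | ⟨b, n⟩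
    · exact ⟨n₀, by simpa [h] using h₀⟩
    · rcases hb : p b n with _ | _
      · exact ⟨n₀, by simpa [h, hb] using h₀⟩
      · exact ⟨n, by simp [h, hb]⟩
  · rintro ⟨n, hn⟩
    exact ⟨Encodable.encode (a, n), by simp [hn]⟩

end

/-- The code of the radius of an ideal ball. -/
def radiusCode (b : (RatCode × RatCode) × ℕ × ℕ) : RatCode := (b.2.1 + 1, 0, b.2.2)

theorem primrec_radiusCode : Primrec radiusCode :=
  (Primrec.succ.comp (Primrec.fst.comp Primrec.snd)).pair
    ((Primrec.const 0).pair (Primrec.snd.comp Primrec.snd))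

theorem ratOf_radiusCode (b : (RatCode × RatCode) × ℕ × ℕ) :
    (ratOf (radiusCode b) : ℝ) = ((b.2.1 : ℝ) + 1) / ((b.2.2 : ℝ) + 1) := by
  simp [ratOf, radiusCode]

theorem ratOf_radiusCode_pos (b : (RatCode × RatCode) × ℕ × ℕ) : 0 < ratOf (radiusCode b) := by
  simp only [ratOf, radiusCode]; push_cast; simp only [sub_zero]; positivity

theorem mem_idealBall {b : (RatCode × RatCode) × ℕ × ℕ} {c : ℂ} :
    c ∈ idealBall planePoint b ↔ ‖c - planePoint b.1‖ < ratOf (radiusCode b) := by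
  rw [idealBall, Metric.mem_ball, dist_eq_norm, ratOf_radiusCode]

theorem exists_planePoint_near (c : ℂ) {ε : ℝ} (hε : 0 < ε) : ∃ p, ‖c - planePoint p‖ < ε := by
  obtain ⟨q, hq, hq'⟩ := exists_rat_btwn (show c.re - ε / 2 < c.re by linarith)
  obtain ⟨r, hr, hr'⟩ := exists_rat_btwn (show c.im - ε / 2 < c.im by linarith)
  obtain ⟨a, rfl⟩ := ratOf_surjective q
  obtain ⟨b, rfl⟩ := ratOf_surjective r
  refine ⟨(a, b), (Complex.norm_le_abs_re_add_abs_im _).trans_lt ?_⟩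
  simp only [planePoint, Complex.sub_re, Complex.sub_im]
  rw [abs_of_pos (by linarith), abs_of_pos (by linarith)]
  linarith

/-- The escape test for the parameters in an ideal ball. -/
def ballEscapeTest (b : (RatCode × RatCode) × ℕ × ℕ) (n : ℕ) : Bool :=
  escapeTest (b.1, radiusCode b) n

theorem primrec_ballEscapeTest : Primrec₂ ballEscapeTest :=
  primrec_escapeTest.comp ((Primrec.fst.comp Primrec.fst).pair
    (primrec_radiusCode.comp Primrec.fst)) Primrec.snd

theorem ballEscapeTest_iff {b : (RatCode × RatCode) × ℕ × ℕ} {n : ℕ} :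
    ballEscapeTest b n = true ↔ Escapes (planePoint b.1) (ratOf (radiusCode b)) n :=
  escapeTest_iff (a := (b.1, radiusCode b)) (ratOf_radiusCode_pos b).le

/-- Supplies the default element for the enumeration: for centre 10 and radius 1 the test at time 1
reads 2 + 1 < 10. -/
theorem exists_ballEscapeTest : ∃ b n, ballEscapeTest b n = true := by
  refine ⟨((natCode 10, natCode 0), 0, 0), 1, ballEscapeTest_iff.mpr ?_⟩
  have h : ‖planePoint (natCode 10, natCode 0)‖ = 10 := by
    rw [← Real.sqrt_sq (norm_nonneg _), norm_planePoint_sq]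
    rw [show (10 : ℝ) = √(10 ^ 2) by rw [Real.sqrt_sq (by norm_num)]]
    norm_num
  simp only [Escapes, orbit_succ, orbitError, ratOf_radiusCode, orbit_zero]
  rw [zero_pow two_ne_zero, zero_add, h]
  norm_num

theorem isLowerComputableOpen_compl_mandelbrot :
    IsLowerComputableOpen planePoint mandelbrotᶜ := by
  obtain ⟨b₀, n₀, h₀⟩ := exists_ballEscapeTest
  obtain ⟨f, hf, hrange⟩ := exists_computable_range primrec_ballEscapeTest h₀
  refine ⟨f, hf, Set.Subset.antisymm (fun c hc => ?_) (Set.iUnion_subset fun k c hc => ?_)⟩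
  · obtain ⟨n, hn⟩ := exists_eventually_escapes hc
    obtain ⟨ε, hε, hball⟩ := Metric.eventually_nhds_iff.mp hn
    obtain ⟨m, hm⟩ := exists_nat_one_div_lt hε
    obtain ⟨p, hp⟩ := exists_planePoint_near c (show (0 : ℝ) < 1 / (m + 1) by positivity)
    have hr : (ratOf (radiusCode (p, 0, m)) : ℝ) = 1 / (m + 1) := by simp [ratOf_radiusCode]
    have hesc : Escapes (planePoint p) (ratOf (radiusCode (p, 0, m))) n := by
      rw [hr]
      refine @hball (planePoint p, 1 / (m + 1)) ?_
      rw [Prod.dist_eq, max_lt_iff, dist_comm, dist_eq_norm, Real.dist_eq, sub_zero,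
        abs_of_pos (by positivity)]
      exact ⟨hp.trans hm, hm⟩
    obtain ⟨k, hk⟩ := (hrange (p, 0, m)).mpr ⟨n, ballEscapeTest_iff.mpr hesc⟩
    refine Set.mem_iUnion.mpr ⟨k, ?_⟩
    rw [hk, mem_idealBall, hr]
    exact hp
  · obtain ⟨n, hn⟩ := (hrange (f k)).mp ⟨k, rfl⟩
    exact (ballEscapeTest_iff.mp hn).notMem_mandelbrot (mem_idealBall.mp hc).le

/-! ### Grid approximations of the Mandelbrot set -/

/-- The lower left corners of the cells of the grid of mesh `1 / (k + 1)` on `[-3, 3) × [-3, 3)`. -/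
def corner (k : ℕ) (q : ℕ × ℕ) : RatCode × RatCode :=
  ((q.1, 3 * (k + 1), k), (q.2, 3 * (k + 1), k))

/-- A bound for the diameter of the cells. -/
def meshCode (k : ℕ) : RatCode := (2, 0, k)

/-- The cells of the grid of mesh `1 / (k + 1)` on `[-3, 3) × [-3, 3)`. -/
def cell (k : ℕ) (q : ℕ × ℕ) : Set ℂ :=
  Set.Ico ((q.1 : ℝ) / (k + 1) - 3) (((q.1 : ℝ) + 1) / (k + 1) - 3) ×ℂ
    Set.Ico ((q.2 : ℝ) / (k + 1) - 3) (((q.2 : ℝ) + 1) / (k + 1) - 3)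

/-- The indices of the cells. -/
def gridList (k : ℕ) : List (ℕ × ℕ) :=
  List.range (6 * (k + 1)) ×ˢ List.range (6 * (k + 1))

/-- Whether the escape test succeeds before time `k`. -/
def escapesBefore (a : (RatCode × RatCode) × RatCode) (k : ℕ) : Bool :=
  decide (∃ n < k, escapeTest a n = true)

/-- Whether the closed ball with code `a` lies in the ideal ball `b` by the triangle inequality. -/
def insideTest (b : (RatCode × RatCode) × ℕ × ℕ) (a : (RatCode × RatCode) × RatCode) : Bool :=
  let r := addCode (radiusCode b) (negCode a.2)
  let x := addCode a.1.1 (negCode b.1.1)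
  let y := addCode a.1.2 (negCode b.1.2)
  ltCode (natCode 0) r && ltCode (addCode (mulCode x x) (mulCode y y)) (mulCode r r)

/-- Whether a cell is not known to lie in the complement of the Mandelbrot set or in `b`. -/
def keepTest (b : (RatCode × RatCode) × ℕ × ℕ) (k : ℕ) (q : ℕ × ℕ) : Bool :=
  !(escapesBefore (corner k q, meshCode k) k) && !(insideTest b (corner k q, meshCode k))

/-- The cells not known to lie in the complement of the Mandelbrot set or in `b`. -/
def keepList (b : (RatCode × RatCode) × ℕ × ℕ) (k : ℕ) : List (ℕ × ℕ) :=
  (gridList k).filter (keepTest b k)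

/-- The union of the cells not known to lie in the complement of the Mandelbrot set or in `b`. -/
def region (b : (RatCode × RatCode) × ℕ × ℕ) (k : ℕ) : Set ℂ :=
  ⋃ q ∈ (keepList b k).toFinset, cell k q

/-- The code of the area of `region b k`. -/
def areaCode (b : (RatCode × RatCode) × ℕ × ℕ) (k : ℕ) : RatCode :=
  -- Number of kept cells over (k + 1)², the denominator again stored minus one.
  ((keepList b k).length, 0, k * k + 2 * k)

section

open Primrec

theorem primrec_corner : Primrec₂ corner := by
  have h : Primrec fun r : ℕ × ℕ × ℕ => (3 * (r.1 + 1), r.1) :=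
    (nat_mul.comp (const 3) (succ.comp fst)).pair fst
  exact ((fst.comp snd).pair h).pair ((snd.comp snd).pair h)

theorem primrec_meshCode : Primrec meshCode := (const 2).pair ((const 0).pair Primrec.id)

theorem primrec_gridSize : Primrec fun k : ℕ => 6 * (k + 1) :=
  nat_mul.comp (const 6) succ

theorem primrec_gridList : Primrec gridList :=
  list_flatMap (list_range.comp primrec_gridSize)
    (list_map (list_range.comp (primrec_gridSize.comp fst))
      (Primrec₂.pair.comp (snd.comp fst) snd))

theorem primrec_escapesBefore : Primrec₂ escapesBefore := by
  have h : PrimrecRel fun (l : List ℕ) (a : (RatCode × RatCode) × RatCode) =>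
      ∃ n ∈ l, escapeTest a n = true :=
    PrimrecRel.exists_mem_list (Primrec.eq.comp (primrec_escapeTest.comp snd fst) (const true))
  have h' : PrimrecRel fun (a : (RatCode × RatCode) × RatCode) k =>
      ∃ n < k, escapeTest a n = true :=
    (h.comp (list_range.comp snd) fst).of_eq (by simp)
  exact h'.decide

theorem primrec_insideTest : Primrec₂ insideTest := by
  have r : Primrec fun p : ((RatCode × RatCode) × ℕ × ℕ) × ((RatCode × RatCode) × RatCode) =>
      addCode (radiusCode p.1) (negCode p.2.2) :=
    primrec_addCode.comp (primrec_radiusCode.comp fst) (primrec_negCode.comp (snd.comp snd))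
  have x : Primrec fun p : ((RatCode × RatCode) × ℕ × ℕ) × ((RatCode × RatCode) × RatCode) =>
      addCode p.2.1.1 (negCode p.1.1.1) :=
    primrec_addCode.comp (fst.comp (fst.comp snd)) (primrec_negCode.comp (fst.comp (fst.comp fst)))
  have y : Primrec fun p : ((RatCode × RatCode) × ℕ × ℕ) × ((RatCode × RatCode) × RatCode) =>
      addCode p.2.1.2 (negCode p.1.1.2) :=
    primrec_addCode.comp (snd.comp (fst.comp snd)) (primrec_negCode.comp (snd.comp (fst.comp fst)))
  exact Primrec.and.comp (primrec_ltCode.comp (const _) r)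
    (primrec_ltCode.comp (primrec_addCode.comp (primrec_mulCode.comp x x)
      (primrec_mulCode.comp y y)) (primrec_mulCode.comp r r))

theorem primrec_keepTest :
    Primrec fun p : ((RatCode × RatCode) × ℕ × ℕ) × ℕ × ℕ × ℕ => keepTest p.1 p.2.1 p.2.2 := by
  have a : Primrec fun p : ((RatCode × RatCode) × ℕ × ℕ) × ℕ × ℕ × ℕ =>
      (corner p.2.1 p.2.2, meshCode p.2.1) :=
    (primrec_corner.comp (fst.comp snd) (snd.comp snd)).pair (primrec_meshCode.comp (fst.comp snd))
  exact Primrec.and.comp (Primrec.not.comp (primrec_escapesBefore.comp a (fst.comp snd)))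
    (Primrec.not.comp (primrec_insideTest.comp fst a))

theorem primrec_keepList : Primrec₂ keepList := by
  have hg : Primrec fun r : (ℕ × ℕ) × (((RatCode × RatCode) × ℕ × ℕ) × ℕ) =>
      (r.2.1, r.2.2, r.1) :=
    (fst.comp snd).pair ((snd.comp snd).pair fst)
  have h0 := primrec_keepTest.comp hg
  have h : PrimrecRel fun (q : ℕ × ℕ) (p : ((RatCode × RatCode) × ℕ × ℕ) × ℕ) =>
      keepTest p.1 p.2 q = true :=
    Primrec.eq.comp h0 (const true)
  exact (h.listFilter.comp (primrec_gridList.comp snd) Primrec.id).of_eq fun p => by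
    simp [keepList]

theorem primrec_areaCode : Primrec₂ areaCode :=
  (list_length.comp primrec_keepList).pair ((const 0).pair
    (nat_add.comp (nat_mul.comp snd snd) (nat_mul.comp (const 2) snd)))

end

/-! ### Geometry of the cells and convergence of the region areas. -/

theorem ratOf_meshCode (k : ℕ) : (ratOf (meshCode k) : ℝ) = 2 / (k + 1) := by
  simp [ratOf, meshCode]

theorem ratOf_meshCode_nonneg (k : ℕ) : 0 ≤ ratOf (meshCode k) := by
  simp only [ratOf, meshCode, Nat.cast_zero, sub_zero]; positivity

theorem planePoint_corner (k : ℕ) (q : ℕ × ℕ) :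
    planePoint (corner k q) = ⟨(q.1 : ℝ) / (k + 1) - 3, (q.2 : ℝ) / (k + 1) - 3⟩ := by
  have h : (k : ℝ) + 1 ≠ 0 := by positivity
  apply Complex.ext <;> simp [planePoint, corner, ratOf] <;> field_simp

theorem mem_cell {k : ℕ} {q : ℕ × ℕ} {c : ℂ} :
    c ∈ cell k q ↔ ((q.1 : ℝ) ≤ (c.re + 3) * (k + 1) ∧ (c.re + 3) * (k + 1) < q.1 + 1) ∧
      ((q.2 : ℝ) ≤ (c.im + 3) * (k + 1) ∧ (c.im + 3) * (k + 1) < q.2 + 1) := by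
  have h : (0 : ℝ) < k + 1 := by positivity
  simp only [cell, Complex.mem_reProdIm, Set.mem_Ico, sub_le_iff_le_add, lt_sub_iff_add_lt,
    div_le_iff₀ h, lt_div_iff₀ h]

theorem norm_sub_corner_le {k : ℕ} {q : ℕ × ℕ} {c : ℂ} (hc : c ∈ cell k q) :
    ‖c - planePoint (corner k q)‖ ≤ ratOf (meshCode k) := by
  obtain ⟨⟨h1, h2⟩, h3, h4⟩ := Complex.mem_reProdIm.mp hc
  rw [planePoint_corner, ratOf_meshCode]
  refine (Complex.norm_le_abs_re_add_abs_im _).trans ?_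
  simp only [Complex.sub_re, Complex.sub_im]
  rw [abs_of_nonneg (by linarith), abs_of_nonneg (by linarith)]
  rw [add_div] at h2 h4
  have : (2 : ℝ) / (k + 1) = 1 / (k + 1) + 1 / (k + 1) := by ring
  linarith

theorem measurableSet_cell (k : ℕ) (q : ℕ × ℕ) : MeasurableSet (cell k q) :=
  (Complex.measurable_re measurableSet_Ico).inter (Complex.measurable_im measurableSet_Ico)

theorem volume_cell (k : ℕ) (q : ℕ × ℕ) :
    volume (cell k q) = ENNReal.ofReal (1 / ((k : ℝ) + 1) ^ 2) := by
  have h := Complex.volume_preserving_equiv_real_prod.measure_preimage_equiv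
    (Set.Ico ((q.1 : ℝ) / (k + 1) - 3) (((q.1 : ℝ) + 1) / (k + 1) - 3) ×ˢ
      Set.Ico ((q.2 : ℝ) / (k + 1) - 3) (((q.2 : ℝ) + 1) / (k + 1) - 3))
  have h' : cell k q = Complex.measurableEquivRealProd ⁻¹'
    (Set.Ico ((q.1 : ℝ) / (k + 1) - 3) (((q.1 : ℝ) + 1) / (k + 1) - 3) ×ˢ
      Set.Ico ((q.2 : ℝ) / (k + 1) - 3) (((q.2 : ℝ) + 1) / (k + 1) - 3)) := rfl
  rw [h', h, Measure.volume_eq_prod, Measure.prod_prod, Real.volume_Ico, Real.volume_Ico,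
    ← ENNReal.ofReal_mul (by rw [sub_sub_sub_cancel_right, ← sub_div]; norm_num; positivity)]
  congr 1
  have : (k : ℝ) + 1 ≠ 0 := by positivity
  field_simp
  ring

theorem volume_real_cell (k : ℕ) (q : ℕ × ℕ) :
    volume.real (cell k q) = 1 / ((k : ℝ) + 1) ^ 2 := by
  rw [Measure.real, volume_cell, ENNReal.toReal_ofReal (by positivity)]

theorem disjoint_cell {k : ℕ} {q q' : ℕ × ℕ} (h : q ≠ q') : Disjoint (cell k q) (cell k q') := by
  refine Set.disjoint_left.mpr fun c hc hc' => h ?_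
  obtain ⟨⟨h1, h2⟩, h3, h4⟩ := mem_cell.mp hc
  obtain ⟨⟨h1', h2'⟩, h3', h4'⟩ := mem_cell.mp hc'
  have e : ∀ m n : ℕ, ∀ t : ℝ, (m : ℝ) ≤ t → t < n + 1 → m ≤ n := fun m n t hm hn => by
    have : (m : ℝ) < ((n + 1 : ℕ) : ℝ) := by push_cast; linarith
    exact Nat.lt_succ_iff.mp (by exact_mod_cast this)
  exact Prod.ext (le_antisymm (e _ _ _ h1 h2') (e _ _ _ h1' h2))
    (le_antisymm (e _ _ _ h3 h4') (e _ _ _ h3' h4))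

theorem mem_gridList {k : ℕ} {q : ℕ × ℕ} :
    q ∈ gridList k ↔ q.1 < 6 * (k + 1) ∧ q.2 < 6 * (k + 1) := by
  simp [gridList, SProd.sprod, List.pair_mem_product (x := q.1) (y := q.2)]

theorem nodup_keepList (b : (RatCode × RatCode) × ℕ × ℕ) (k : ℕ) : (keepList b k).Nodup :=
  (List.nodup_range.product List.nodup_range).filter _

theorem exists_mem_cell {c : ℂ} (hc : ‖c‖ ≤ 2) (k : ℕ) : ∃ q ∈ gridList k, c ∈ cell k q := by
  have key : ∀ t : ℝ, |t| ≤ 2 → ⌊(t + 3) * (k + 1)⌋₊ < 6 * (k + 1) ∧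
      ((⌊(t + 3) * (k + 1)⌋₊ : ℕ) : ℝ) ≤ (t + 3) * (k + 1) ∧
      (t + 3) * (k + 1) < ((⌊(t + 3) * (k + 1)⌋₊ : ℕ) : ℝ) + 1 := by
    intro t ht
    obtain ⟨h1, h2⟩ := abs_le.mp ht
    have h0 : 0 ≤ (t + 3) * ((k : ℝ) + 1) := mul_nonneg (by linarith) (by positivity)
    refine ⟨(Nat.floor_lt h0).mpr ?_, Nat.floor_le h0, Nat.lt_floor_add_one _⟩
    push_cast
    nlinarith [Nat.cast_nonneg (α := ℝ) k]
  obtain ⟨h1, h1'⟩ := key c.re ((Complex.abs_re_le_norm c).trans hc)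
  obtain ⟨h2, h2'⟩ := key c.im ((Complex.abs_im_le_norm c).trans hc)
  exact ⟨(⌊(c.re + 3) * (k + 1)⌋₊, ⌊(c.im + 3) * (k + 1)⌋₊), mem_gridList.mpr ⟨h1, h2⟩,
    mem_cell.mpr ⟨h1', h2'⟩⟩

theorem escapesBefore_iff {a : (RatCode × RatCode) × RatCode} (ha : 0 ≤ ratOf a.2) {k : ℕ} :
    escapesBefore a k = true ↔ ∃ n < k, Escapes (planePoint a.1) (ratOf a.2) n := by
  simp only [escapesBefore, decide_eq_true_iff, escapeTest_iff ha]

theorem insideTest_iff {b : (RatCode × RatCode) × ℕ × ℕ} {a : (RatCode × RatCode) × RatCode} :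
    insideTest b a = true ↔
      ‖planePoint a.1 - planePoint b.1‖ + ratOf a.2 < ratOf (radiusCode b) := by
  have h : planePoint a.1 - planePoint b.1 =
      planePoint (addCode a.1.1 (negCode b.1.1), addCode a.1.2 (negCode b.1.2)) := by
    apply Complex.ext <;> simp [planePoint, sub_eq_add_neg]
  -- Positivity of the difference of radii is tested separately, since otherwise the squared
  -- inequality could hold with a negative right-hand side.
  have h1 : insideTest b a = true ↔ (0 : ℝ) < ratOf (radiusCode b) - ratOf a.2 ∧
      ‖planePoint a.1 - planePoint b.1‖ ^ 2 < (ratOf (radiusCode b) - ratOf a.2 : ℝ) ^ 2 := by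
    rw [h, norm_planePoint_sq]
    simp only [insideTest, Bool.and_eq_true, ltCode_iff]
    rw [← Rat.cast_lt (K := ℝ), ← Rat.cast_lt (K := ℝ)]
    simp [sub_eq_add_neg, sq]
  rw [h1]
  constructor
  · rintro ⟨h2, h3⟩
    have := (pow_lt_pow_iff_left₀ (norm_nonneg _) h2.le two_ne_zero).mp h3
    linarith
  · intro h2
    have := norm_nonneg (planePoint a.1 - planePoint b.1)
    exact ⟨by linarith, pow_lt_pow_left₀ (by linarith) (norm_nonneg _) two_ne_zero⟩

theorem mem_region {b : (RatCode × RatCode) × ℕ × ℕ} {k : ℕ} {c : ℂ} :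
    c ∈ region b k ↔ ∃ q ∈ gridList k, keepTest b k q = true ∧ c ∈ cell k q := by
  simp [region, keepList, and_assoc]

theorem diff_idealBall_subset_region (b : (RatCode × RatCode) × ℕ × ℕ) (k : ℕ) :
    mandelbrot \ idealBall planePoint b ⊆ region b k := by
  rintro c ⟨hM, hb⟩
  obtain ⟨q, hq, hc⟩ := exists_mem_cell (norm_orbit_le_two hM).1 k
  refine mem_region.mpr ⟨q, hq, ?_, hc⟩
  have hd := norm_sub_corner_le hc
  simp only [keepTest, Bool.and_eq_true, Bool.not_eq_true', Bool.eq_false_iff, ne_eq,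
    escapesBefore_iff (a := (corner k q, meshCode k)) (ratOf_meshCode_nonneg k), insideTest_iff]
  refine ⟨?_, fun h => hb (mem_idealBall.mpr ?_)⟩
  · rintro ⟨n, -, hn⟩
    exact hn.notMem_mandelbrot hd hM
  · have := norm_sub_le_norm_sub_add_norm_sub c (planePoint (corner k q)) (planePoint b.1)
    linarith

theorem tendsto_ratOf_meshCode : Tendsto (fun k => (ratOf (meshCode k) : ℝ)) atTop (𝓝 0) := by
  have h := (tendsto_one_div_add_atTop_nhds_zero_nat (𝕜 := ℝ)).const_mul 2
  simp only [mul_zero, mul_one_div] at h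
  simpa only [ratOf_meshCode] using h

/-- Open conditions on the centre and the radius hold for all small cells containing a point. -/
theorem eventually_forall_cell {c : ℂ} {P : ℂ × ℝ → Prop} (hP : ∀ᶠ p in 𝓝 (c, (0 : ℝ)), P p) :
    ∀ᶠ k in atTop, ∀ q, c ∈ cell k q → P (planePoint (corner k q), ratOf (meshCode k)) := by
  obtain ⟨ε, hε, hball⟩ := Metric.eventually_nhds_iff.mp hP
  filter_upwards [tendsto_ratOf_meshCode.eventually (gt_mem_nhds hε)] with k hk q hc
  refine hball ?_
  have h0 : (0 : ℝ) ≤ ratOf (meshCode k) := by exact_mod_cast ratOf_meshCode_nonneg k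
  rw [Prod.dist_eq, max_lt_iff, dist_comm, dist_eq_norm, Real.dist_eq, sub_zero, abs_of_nonneg h0]
  exact ⟨(norm_sub_corner_le hc).trans_lt hk, hk⟩

/-- Pointwise stabilization of the indicators. A point off M is removed by an escape certificate, a
point of M in the open ball by the inside test, and the points of M outside the ball are never
removed. -/
theorem eventually_mem_region_iff (b : (RatCode × RatCode) × ℕ × ℕ) (c : ℂ) :
    ∀ᶠ k in atTop, c ∈ region b k ↔ c ∈ mandelbrot \ idealBall planePoint b := by
  by_cases hc : c ∈ mandelbrot \ idealBall planePoint b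
  · exact Eventually.of_forall fun k => ⟨fun _ => hc, fun _ => diff_idealBall_subset_region b k hc⟩
  have key : ∀ᶠ k in atTop, ∀ q, c ∈ cell k q → keepTest b k q = false := by
    by_cases hM : c ∈ mandelbrot
    · have hb : c ∈ idealBall planePoint b := by
        by_contra hb; exact hc ⟨hM, hb⟩
      have hev : ∀ᶠ p : ℂ × ℝ in 𝓝 (c, 0), ‖p.1 - planePoint b.1‖ + p.2 < ratOf (radiusCode b) := by
        refine (isOpen_lt (by fun_prop) continuous_const).mem_nhds ?_
        simpa using mem_idealBall.mp hb
      filter_upwards [eventually_forall_cell hev] with k hk q hq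
      have := (insideTest_iff (a := (corner k q, meshCode k))).mpr (hk q hq)
      simp [keepTest, this]
    · obtain ⟨n, hn⟩ := exists_eventually_escapes hM
      filter_upwards [eventually_forall_cell hn, eventually_gt_atTop n] with k hk hnk q hq
      have := (escapesBefore_iff (a := (corner k q, meshCode k)) (ratOf_meshCode_nonneg k)).mpr
        ⟨n, hnk, hk q hq⟩
      simp [keepTest, this]
  filter_upwards [key] with k hk
  refine ⟨fun h => ?_, fun h => absurd h hc⟩
  obtain ⟨q, -, hq, hcq⟩ := mem_region.mp h
  simp [hk q hcq] at hq

theorem measurableSet_region (b : (RatCode × RatCode) × ℕ × ℕ) (k : ℕ) :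
    MeasurableSet (region b k) :=
  Finset.measurableSet_biUnion _ fun q _ => measurableSet_cell k q

theorem ratOf_areaCode_eq (b : (RatCode × RatCode) × ℕ × ℕ) (k : ℕ) :
    (ratOf (areaCode b k) : ℝ) = (keepList b k).length * (1 / ((k : ℝ) + 1) ^ 2) := by
  simp only [ratOf, areaCode]
  push_cast
  rw [sub_zero, mul_one_div]
  congr 1
  ring

theorem volume_real_region (b : (RatCode × RatCode) × ℕ × ℕ) (k : ℕ) :
    volume.real (region b k) = ratOf (areaCode b k) := by
  rw [Measure.real, region, measure_biUnion_finset (fun q _ q' _ h => disjoint_cell h)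
    fun q _ => measurableSet_cell k q, ENNReal.toReal_sum fun q _ => by simp [volume_cell]]
  have h := volume_real_cell k
  simp only [Measure.real] at h
  simp only [h]
  rw [Finset.sum_const, List.toFinset_card_of_nodup (nodup_keepList b k), nsmul_eq_mul,
    ratOf_areaCode_eq]

theorem region_subset_closedBall (b : (RatCode × RatCode) × ℕ × ℕ) (k : ℕ) :
    region b k ⊆ Metric.closedBall 0 6 := by
  intro c hc
  obtain ⟨q, hq, -, hcq⟩ := mem_region.mp hc
  obtain ⟨⟨h1, h2⟩, h3, h4⟩ := mem_cell.mp hcq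
  obtain ⟨h5, h6⟩ := mem_gridList.mp hq
  have key : ∀ (m : ℕ) (t : ℝ), m < 6 * (k + 1) → (m : ℝ) ≤ (t + 3) * (k + 1) →
      (t + 3) * (k + 1) < m + 1 → |t| ≤ 3 := by
    intro m t hm hl hu
    have hm' : (m : ℝ) + 1 ≤ 6 * (k + 1) := by exact_mod_cast hm
    have hk : (0 : ℝ) < k + 1 := by positivity
    have h7 : 0 ≤ t + 3 := nonneg_of_mul_nonneg_left ((Nat.cast_nonneg m).trans hl) hk
    have h8 : t + 3 < 6 := lt_of_mul_lt_mul_right (hu.trans_le hm') hk.le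
    exact abs_le.mpr ⟨by linarith, by linarith⟩
  rw [mem_closedBall_zero_iff]
  refine (Complex.norm_le_abs_re_add_abs_im c).trans ?_
  linarith [key _ _ h5 h1 h2, key _ _ h6 h3 h4]

theorem volume_region_ne_top (b : (RatCode × RatCode) × ℕ × ℕ) (k : ℕ) :
    volume (region b k) ≠ ⊤ :=
  ((measure_mono (region_subset_closedBall b k)).trans_lt measure_closedBall_lt_top).ne

theorem volume_mandelbrot_ne_top : volume mandelbrot ≠ ⊤ :=
  ((measure_mono mandelbrot_subset_closedBall).trans_lt measure_closedBall_lt_top).ne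

theorem volume_real_diff_le_areaCode (b : (RatCode × RatCode) × ℕ × ℕ) (k : ℕ) :
    volume.real (mandelbrot \ idealBall planePoint b) ≤ ratOf (areaCode b k) := by
  rw [← volume_real_region]
  exact measureReal_mono (diff_idealBall_subset_region b k) (volume_region_ne_top b k)

theorem tendsto_ratOf_areaCode (b : (RatCode × RatCode) × ℕ × ℕ) :
    Tendsto (fun k => (ratOf (areaCode b k) : ℝ)) atTop
      (𝓝 (volume.real (mandelbrot \ idealBall planePoint b))) := by
  simp only [← volume_real_region]
  refine (ENNReal.tendsto_toReal ?_).comp (tendsto_measure_of_tendsto_indicator atTop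
    (measurableSet_region b) (measurableSet_closedBall (x := (0 : ℂ)) (ε := 6))
    measure_closedBall_lt_top.ne (Eventually.of_forall (region_subset_closedBall b))
    (eventually_mem_region_iff b))
  exact ((measure_mono Set.sdiff_subset).trans_lt volume_mandelbrot_ne_top.lt_top).ne

/-- An ideal ball disjoint from the Mandelbrot set. -/
def farBall : (RatCode × RatCode) × ℕ × ℕ := ((natCode 10, natCode 0), 0, 0)

/-- With this ball the regions built for M \ B approximate M itself, so a single construction serves
both purposes. -/
theorem diff_farBall : mandelbrot \ idealBall planePoint farBall = mandelbrot := by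
  refine sdiff_eq_left.mpr (Set.disjoint_left.mpr fun c hc hb => ?_)
  have h := mem_idealBall.mp hb
  have h1 := (Complex.abs_re_le_norm (c - planePoint farBall.1)).trans_lt h
  have h2 := (Complex.abs_re_le_norm c).trans (norm_orbit_le_two hc).1
  rw [abs_lt] at h1
  rw [abs_le] at h2
  simp [planePoint, farBall, ratOf_radiusCode] at h1
  linarith

theorem volume_mandelbrot_le_areaCode (k : ℕ) :
    volume.real mandelbrot ≤ ratOf (areaCode farBall k) := by
  simpa only [diff_farBall] using volume_real_diff_le_areaCode farBall k

theorem tendsto_ratOf_areaCode_farBall :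
    Tendsto (fun k => (ratOf (areaCode farBall k) : ℝ)) atTop (𝓝 (volume.real mandelbrot)) := by
  simpa only [diff_farBall] using tendsto_ratOf_areaCode farBall

/-! ### Upper-computability of the area. -/

/-- The minimum of two codes. -/
def minCode (p q : RatCode) : RatCode := bif ltCode p q then p else q

theorem primrec_minCode : Primrec₂ minCode :=
  Primrec.cond primrec_ltCode Primrec.fst Primrec.snd

theorem ratOf_minCode (p q : RatCode) : ratOf (minCode p q) = min (ratOf p) (ratOf q) := by
  unfold minCode
  rcases h : ltCode p q with _ | _
  · have h' : ¬ ratOf p < ratOf q := by rw [← ltCode_iff, h]; simp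
    rw [cond_false, min_eq_right (not_lt.mp h')]
  · rw [cond_true, min_eq_left (ltCode_iff.mp h).le]

theorem isUpperComputableReal_of_tendsto {g : ℕ → RatCode} (hg : Computable g) {x : ℝ}
    (hx : ∀ n, x ≤ ratOf (g n)) (hlim : Tendsto (fun n => (ratOf (g n) : ℝ)) atTop (𝓝 x)) :
    IsUpperComputableReal x := by
  -- The running minimum of `g` is non-increasing and stays between the limit and `g`.
  set f : ℕ → RatCode := fun n => Nat.rec (motive := fun _ => RatCode) (g 0)
    (fun m r => minCode (g (m + 1)) r) n with hf
  have hmin : ∀ n, (ratOf (f (n + 1)) : ℝ) = min (ratOf (g (n + 1)) : ℝ) (ratOf (f n)) := by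
    intro n
    rw [← Rat.cast_min, ← ratOf_minCode]
  have hle : ∀ n, x ≤ ratOf (f n) ∧ (ratOf (f n) : ℝ) ≤ ratOf (g n) := by
    intro n
    induction n with
    | zero => exact ⟨hx 0, le_rfl⟩
    | succ n ih => rw [hmin]; exact ⟨le_min (hx _) ih.1, min_le_left _ _⟩
  refine ⟨f, ?_, antitone_nat_of_succ_le fun n => ?_, ?_⟩
  · have hs : Computable fun r : ℕ × ℕ × RatCode => g (r.2.1 + 1) :=
      hg.comp (Computable.succ.comp (Computable.fst.comp Computable.snd))
    have hr : Computable fun r : ℕ × ℕ × RatCode => r.2.2 :=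
      Computable.snd.comp Computable.snd
    have hm : Computable fun r : ℕ × ℕ × RatCode => minCode (g (r.2.1 + 1)) r.2.2 :=
      primrec_minCode.to_comp.comp hs hr
    exact Computable.nat_rec Computable.id (Computable.const (g 0)) hm.to₂
  · rw [hmin]; exact min_le_right _ _
  · exact tendsto_of_tendsto_of_tendsto_of_le_of_le tendsto_const_nhds hlim
      (fun n => (hle n).1) (fun n => (hle n).2)

theorem isUpperComputableReal_volume_mandelbrot :
    IsUpperComputableReal (volume mandelbrot).toReal :=
  isUpperComputableReal_of_tendsto
    (primrec_areaCode.to_comp.comp (Computable.const farBall) Computable.id)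
    volume_mandelbrot_le_areaCode tendsto_ratOf_areaCode_farBall

/-! ### Effective searches and lower-computability of M. -/

/-- The code of `(1 / 2) ^ n`. -/
def powCode (n : ℕ) : RatCode := (mulCode (1, 0, 1))^[n] (natCode 1)

theorem primrec_powCode : Primrec powCode :=
  Primrec.nat_iterate Primrec.id (Primrec.const _)
    (primrec_mulCode.comp (Primrec.const _) Primrec.snd)

theorem ratOf_powCode (n : ℕ) : (ratOf (powCode n) : ℝ) = (1 / 2) ^ n := by
  induction n with
  | zero => simp [powCode]
  | succ n ih =>
    have h : powCode (n + 1) = mulCode (1, 0, 1) (powCode n) := Function.iterate_succ_apply' _ _ _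
    rw [h, ratOf_mulCode, Rat.cast_mul, ih, pow_succ']
    congr 1
    norm_num [ratOf]

theorem rePred_exists {α : Type*} [Primcodable α] {t : α → ℕ → Bool} (ht : Computable₂ t) :
    REPred fun a => ∃ n, t a n = true := by
  have h : Partrec fun a => Nat.rfind fun n => (Part.some (t a n) : Part Bool) :=
    Partrec.rfind ht.partrec₂
  have h' : ∀ a, (Nat.rfind fun n => (Part.some (t a n) : Part Bool)).Dom ↔ ∃ n, t a n = true := by
    intro a
    refine Nat.rfind_dom.trans ?_
    constructor
    · rintro ⟨n, hn, -⟩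
      exact ⟨n, (Part.mem_some_iff.mp hn).symm⟩
    · rintro ⟨n, hn⟩
      exact ⟨n, Part.mem_some_iff.mpr hn.symm, fun _ => trivial⟩
  simpa only [h'] using h.dom_re

theorem exists_computable_search {t : ℕ → ℕ → Bool} (ht : Computable₂ t)
    (h : ∀ n, ∃ k, t n k = true) : ∃ g : ℕ → ℕ, Computable g ∧ ∀ n, t n (g n) = true := by
  have hp : ComputablePred fun p : ℕ × ℕ => t p.1 p.2 = true :=
    ⟨inferInstance, (Computable.of_eq (f := fun p : ℕ × ℕ => t p.1 p.2) ht (by simp))⟩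
  exact ⟨_, Computable.find (P := fun n k => t n k = true) hp h, fun n => Nat.find_spec (h n)⟩

theorem tendsto_computable_approx {x : ℝ} {a : ℕ → RatCode}
    (ha : ∀ n, dist (ratOf (a n) : ℝ) x < (1 / 2 : ℝ) ^ n) :
    Tendsto (fun n => (ratOf (a n) : ℝ)) atTop (𝓝 x) :=
  tendsto_iff_dist_tendsto_zero.mpr (squeeze_zero (fun _ => dist_nonneg) (fun n => (ha n).le)
    (tendsto_pow_atTop_nhds_zero_of_lt_one (by norm_num) (by norm_num)))

theorem isLowerComputableClosed_mandelbrot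
    (hA : IsComputableReal (volume mandelbrot).toReal) :
    IsLowerComputableClosed planePoint mandelbrot := by
  refine ⟨isClosed_mandelbrot, ?_⟩
  obtain ⟨a, hac, ha⟩ := hA
  -- Success at stage k gives area(M \ B) ≤ `areaCode b k` < a_k - 2^(-k) < area(M), so M meets B.
  -- Conversely, if M meets B, the gap between the two areas is positive and is detected in the
  -- limit.
  set t : (RatCode × RatCode) × ℕ × ℕ → ℕ → Bool := fun b k =>
    ltCode (addCode (areaCode b k) (powCode k)) (a k) with ht
  have htc : Computable₂ t :=
    primrec_ltCode.to_comp.comp (primrec_addCode.to_comp.comp primrec_areaCode.to_comp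
      (primrec_powCode.to_comp.comp Computable.snd)) (hac.comp Computable.snd)
  have key : ∀ b, (mandelbrot ∩ idealBall planePoint b).Nonempty ↔ ∃ k, t b k = true := by
    intro b
    have hsplit : volume.real (mandelbrot ∩ idealBall planePoint b) +
        volume.real (mandelbrot \ idealBall planePoint b) = volume.real mandelbrot :=
      measureReal_inter_add_sdiff (measurableSet_ball) volume_mandelbrot_ne_top
    have ht' : ∀ k, t b k = true ↔
        (ratOf (areaCode b k) : ℝ) + (1 / 2) ^ k < ratOf (a k) := by
      intro k
      rw [← ratOf_powCode, ← Rat.cast_add, ← ratOf_addCode, Rat.cast_lt, ← ltCode_iff]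
    simp only [ht']
    constructor
    · rintro ⟨c, hc, hcb⟩
      obtain ⟨ε, hε, hsub⟩ := Metric.isOpen_iff.mp Metric.isOpen_ball c hcb
      have hpos : 0 < volume.real (mandelbrot ∩ idealBall planePoint b) := by
        refine ENNReal.toReal_pos ?_ ?_
        · exact ((volume_mandelbrot_inter_ball_pos hc hε).trans_le
            (measure_mono (Set.inter_subset_inter_right _ hsub))).ne'
        · exact ((measure_mono Set.inter_subset_left).trans_lt volume_mandelbrot_ne_top.lt_top).ne
      have h1 : Tendsto (fun k : ℕ => (ratOf (areaCode b k) : ℝ) + (1 / 2) ^ k) atTop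
          (𝓝 (volume.real (mandelbrot \ idealBall planePoint b) + 0)) :=
        (tendsto_ratOf_areaCode b).add
          (tendsto_pow_atTop_nhds_zero_of_lt_one (by norm_num) (by norm_num))
      refine (h1.eventually_lt (tendsto_computable_approx ha) ?_).exists
      have : (volume mandelbrot).toReal = volume.real mandelbrot := rfl
      linarith
    · rintro ⟨k, hk⟩
      have h1 := volume_real_diff_le_areaCode b k
      have h2 : dist (ratOf (a k) : ℝ) (volume mandelbrot).toReal < (1 / 2) ^ k := ha k
      rw [Real.dist_eq, abs_lt] at h2
      have : (volume mandelbrot).toReal = volume.real mandelbrot := rfl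
      by_contra hne
      rw [Set.not_nonempty_iff_eq_empty.mp hne] at hsplit
      simp only [measureReal_empty] at hsplit
      linarith
  simpa only [key] using rePred_exists htc

/-! ### The normalized area -/

/-- The nearest-point projection to the square. -/
def squareProj (c : ℂ) : square :=
  ⟨⟨max (-2) (min 2 c.re), max (-2) (min 2 c.im)⟩, by
    have h : ∀ t : ℝ, max (-2) (min 2 t) ∈ Set.Icc (-2 : ℝ) 2 := fun t =>
      ⟨le_max_left _ _, max_le (by norm_num) (min_le_left _ _)⟩
    exact Complex.mem_reProdIm.mpr ⟨h _, h _⟩⟩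

theorem squareProj_coe (c : square) : squareProj c = c := by
  obtain ⟨h1, h2⟩ := Complex.mem_reProdIm.mp c.2
  refine Subtype.ext (Complex.ext ?_ ?_)
  · simp only [squareProj]; rw [min_eq_right h1.2, max_eq_right h1.1]
  · simp only [squareProj]; rw [min_eq_right h2.2, max_eq_right h2.1]

/-- The grid extends beyond the square, so corners outside it are clamped; testing a function at the
clamped corners is testing its extension by `squareProj` at the original ones. -/
theorem squareProj_planePoint (p : RatCode × RatCode) :
    squareProj (planePoint p) = squarePoint p := by
  refine Subtype.ext (Complex.ext ?_ ?_) <;> simp [squareProj, planePoint, squarePoint, clamp]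

theorem lipschitzWith_squareProj : LipschitzWith 1 squareProj := by
  have h : ∀ s t : ℝ, |max (-2) (min 2 s) - max (-2) (min 2 t)| ≤ |s - t| := fun s t =>
    (abs_max_sub_max_le_max _ _ _ _).trans (by
      rw [sub_self, abs_zero]
      refine max_le (abs_nonneg _) ((abs_min_sub_min_le_max _ _ _ _).trans ?_)
      rw [sub_self, abs_zero]
      exact max_le (abs_nonneg _) le_rfl)
  refine LipschitzWith.of_dist_le_mul fun c d => ?_
  rw [NNReal.coe_one, one_mul, Subtype.dist_eq, Complex.dist_eq_re_im, Complex.dist_eq_re_im]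
  exact Real.sqrt_le_sqrt (add_le_add (sq_le_sq.mpr (h _ _)) (sq_le_sq.mpr (h _ _)))

/-- Subtracting a constant changes both integrals equally, so test functions may be taken to vanish
at a chosen base point, which makes them bounded. -/
theorem wasserstein_le {X : Type*} [MetricSpace X] [CompactSpace X] [MeasurableSpace X]
    [BorelSpace X] {μ ν : ProbabilityMeasure X} {ε : ℝ} (x₀ : X)
    (h : ∀ f : X → ℝ, LipschitzWith 1 f → f x₀ = 0 →
      |(∫ x, f x ∂(μ : Measure X)) - ∫ x, f x ∂(ν : Measure X)| ≤ ε) :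
    wasserstein μ ν ≤ ε := by
  have : Nonempty {f : X → ℝ // LipschitzWith 1 f} := ⟨⟨fun _ => 0, LipschitzWith.const' 0⟩⟩
  refine ciSup_le fun ⟨f, hf⟩ => ?_
  have hint : ∀ ρ : ProbabilityMeasure X, ∫ x, (f x - f x₀) ∂(ρ : Measure X) =
      (∫ x, f x ∂(ρ : Measure X)) - f x₀ := by
    intro ρ
    rw [integral_sub (hf.continuous.integrable_of_hasCompactSupport
      (HasCompactSupport.of_compactSpace f)) (integrable_const _)]
    simp
  have h1 := h (fun x => f x - f x₀) (LipschitzWith.of_dist_le_mul fun x y => by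
    simpa [dist_sub_right] using hf.dist_le_mul x y) (sub_self _)
  rwa [hint, hint, sub_sub_sub_cancel_right] at h1

theorem integral_diracSum {X ι : Type*} [MetricSpace X] [CompactSpace X] [MeasurableSpace X]
    [BorelSpace X] (s : ι → X) (l : List (ι × ℕ)) {f : X → ℝ} (hf : Continuous f) :
    ∫ x, f x ∂diracSum s l = (l.map fun p => ((p.2 : ℝ) + 1) * f (s p.1)).sum := by
  induction l with
  | nil => simp [diracSum]
  | cons p l ih =>
    have hcons : diracSum s (p :: l) =
        ((p.2 + 1 : ℕ) : ENNReal) • Measure.dirac (s p.1) + diracSum s l := by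
      simp [diracSum]
    have hfin : IsFiniteMeasure (diracSum s l) :=
      ⟨by rw [diracSum_univ]; exact ENNReal.natCast_lt_top _⟩
    have hfin' : IsFiniteMeasure (((p.2 + 1 : ℕ) : ENNReal) • Measure.dirac (s p.1)) :=
      ⟨by rw [Measure.smul_apply, measure_univ, smul_eq_mul, mul_one]
          exact ENNReal.natCast_lt_top _⟩
    have hint : ∀ (ρ : Measure X) [IsFiniteMeasure ρ], Integrable f ρ := fun ρ _ =>
      hf.integrable_of_hasCompactSupport (HasCompactSupport.of_compactSpace f)
    rw [hcons, integral_add_measure (hint _) (hint _), ih, integral_smul_measure, integral_dirac,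
      ENNReal.toReal_natCast]
    simp

/-- The code of the uniform measure on a list of ideal points. -/
def uniformCode {ι : Type*} [Inhabited ι] (l : List ι) : ConvexCode ι :=
  ((l.headI, 0), l.tail.map fun i => (i, 0))

theorem primrec_uniformCode {ι : Type*} [Inhabited ι] [Primcodable ι] :
    Primrec (uniformCode (ι := ι)) :=
  (Primrec.list_headI.pair (Primrec.const 0)).pair
    (Primrec.list_map Primrec.list_tail (Primrec.snd.pair (Primrec.const 0)))

theorem integral_idealMeasure_uniformCode {X ι : Type*} [Inhabited ι] [MetricSpace X]
    [CompactSpace X] [MeasurableSpace X] [BorelSpace X] (s : ι → X) {l : List ι} (hl : l ≠ [])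
    {f : X → ℝ} (hf : Continuous f) :
    ∫ x, f x ∂(idealMeasure s (uniformCode l) : Measure X) =
      (l.length : ℝ)⁻¹ * (l.map fun i => f (s i)).sum := by
  have h1 : (uniformCode l).1 :: (uniformCode l).2 = l.map fun i => (i, 0) := by
    cases l with
    | nil => exact absurd rfl hl
    | cons a l => rfl
  have h2 : (idealMeasure s (uniformCode l) : Measure X) =
      ((totalWeight ((uniformCode l).1 :: (uniformCode l).2) : ENNReal))⁻¹ •
        diracSum s ((uniformCode l).1 :: (uniformCode l).2) := rfl
  rw [h2, h1, integral_smul_measure, integral_diracSum s _ hf]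
  simp [totalWeight, Function.comp_def]

/-- Moves integrals from the square to the plane, where the grid lives. -/
theorem mandelbrotMeasure_apply_integral (f : square → ℝ) :
    ∫ x, f x ∂(mandelbrotMeasure : Measure square) = ∫ c in mandelbrot, f (squareProj c) := by
  have h1 : (mandelbrotMeasure : Measure square) =
      squareVolume.restrict (Subtype.val ⁻¹' mandelbrot) := rfl
  have h2 : ∫ x in Subtype.val ⁻¹' mandelbrot, f x ∂squareVolume =
      ∫ x in (Subtype.val : square → ℂ) ⁻¹' mandelbrot, f (squareProj x) ∂squareVolume := by
    simp only [squareProj_coe]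
  rw [h1, h2, squareVolume]
  have h3 := (MeasurableEmbedding.subtype_coe measurableSet_square).setIntegral_map
    (μ := Measure.comap Subtype.val (volume : Measure ℂ)) (fun c => f (squareProj c)) mandelbrot
  rw [← h3, (MeasurableEmbedding.subtype_coe measurableSet_square).map_comap, Subtype.range_coe,
    Measure.restrict_restrict isClosed_mandelbrot.measurableSet,
    Set.inter_eq_left.mpr mandelbrot_subset_square]

theorem mass_mandelbrotMeasure : (mandelbrotMeasure.mass : ℝ) = volume.real mandelbrot := by
  have h : (mandelbrotMeasure.mass : ℝ) = (mandelbrotMeasure : Measure square).real Set.univ := rfl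
  have h1 := mandelbrotMeasure_apply_integral fun _ => 1
  simp only [integral_const, smul_eq_mul, mul_one, measureReal_restrict_apply_univ] at h1
  exact h.trans h1

theorem nonempty_keepList {k : ℕ} (hA : 0 < volume.real mandelbrot) : keepList farBall k ≠ [] := by
  intro h
  have := volume_mandelbrot_le_areaCode k
  rw [ratOf_areaCode_eq, h] at this
  simp only [List.length_nil, Nat.cast_zero, zero_mul] at this
  linarith

/-- Sums over the corners of the cells approximate integrals over the region. -/
theorem abs_setIntegral_region_sub_le (b : (RatCode × RatCode) × ℕ × ℕ) (k : ℕ) {F : ℂ → ℝ}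
    (hF : LipschitzWith 1 F) :
    |(∫ c in region b k, F c) - 1 / ((k : ℝ) + 1) ^ 2 *
      ((keepList b k).map fun q => F (planePoint (corner k q))).sum| ≤
      (ratOf (areaCode b k) : ℝ) * ratOf (meshCode k) := by
  have hfin : ∀ q, volume (cell k q) < ⊤ := fun q => by
    rw [volume_cell]; exact ENNReal.ofReal_lt_top
  have hbound : ∀ q, ∀ c ∈ cell k q, ‖F c - F (planePoint (corner k q))‖ ≤ ratOf (meshCode k) := by
    intro q c hc
    have h := hF.dist_le_mul c (planePoint (corner k q))
    rw [NNReal.coe_one, one_mul, dist_eq_norm, dist_eq_norm] at h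
    exact h.trans (norm_sub_corner_le hc)
  have hint' : ∀ q, IntegrableOn (fun c => F c - F (planePoint (corner k q))) (cell k q) := fun q =>
    Measure.integrableOn_of_bounded (hfin q).ne
      (hF.continuous.sub continuous_const).aestronglyMeasurable
      ((ae_restrict_iff' (measurableSet_cell k q)).mpr (ae_of_all _ (hbound q)))
  have hint : ∀ q, IntegrableOn F (cell k q) := fun q => by
    have := (hint' q).add (integrableOn_const (C := F (planePoint (corner k q))) (hfin q).ne enorm_ne_top)
    simpa [Pi.add_def] using this
  have hcell : ∀ q, |(∫ c in cell k q, F c) - 1 / ((k : ℝ) + 1) ^ 2 * F (planePoint (corner k q))| ≤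
      ratOf (meshCode k) * (1 / ((k : ℝ) + 1) ^ 2) := by
    intro q
    have h := norm_setIntegral_le_of_norm_le_const (hfin q) (hbound q)
    rw [integral_sub (hint q) (integrableOn_const (hfin q).ne enorm_ne_top), setIntegral_const,
      volume_real_cell, smul_eq_mul, Real.norm_eq_abs] at h
    exact h
  rw [region, integral_biUnion_finset _ (fun q _ => measurableSet_cell k q)
    (fun q _ q' _ h => disjoint_cell h) (fun q _ => hint q),
    ← List.sum_toFinset _ (nodup_keepList b k), Finset.mul_sum, ← Finset.sum_sub_distrib]
  refine (Finset.abs_sum_le_sum_abs _ _).trans ((Finset.sum_le_sum fun q _ => hcell q).trans ?_)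
  rw [Finset.sum_const, List.toFinset_card_of_nodup (nodup_keepList b k), nsmul_eq_mul,
    ratOf_areaCode_eq]
  exact le_of_eq (by ring)

/-- With A and Q the areas of M and of the region, passing from corner sums to integrals costs the
mesh; replacing the region by M and changing the normalization from 1/Q to 1/A cost 3 (Q - A) / A
each. -/
theorem wasserstein_uniformCode_le (hA : 0 < volume.real mandelbrot) (k : ℕ) :
    wasserstein (idealMeasure squarePoint (uniformCode ((keepList farBall k).map (corner k))))
      mandelbrotMeasure.normalize ≤
      6 / volume.real mandelbrot * ((ratOf (areaCode farBall k) : ℝ) - volume.real mandelbrot) +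
        ratOf (meshCode k) := by
  set A := volume.real mandelbrot with hAdef
  set Q := (ratOf (areaCode farBall k) : ℝ) with hQ
  have hAQ : A ≤ Q := volume_mandelbrot_le_areaCode k
  have hQ0 : 0 < Q := hA.trans_le hAQ
  set x₀ : square := squareProj 0
  refine wasserstein_le x₀ fun f hf hf0 => ?_
  set F : ℂ → ℝ := fun c => f (squareProj c) with hF
  have hFlip : LipschitzWith 1 F := by
    have h := hf.comp lipschitzWith_squareProj
    rwa [one_mul] at h
  -- Points of the square are within 2√2 < 3 of the base point 0.
  have hFbd : ∀ c, ‖F c‖ ≤ 3 := by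
    intro c
    have h1 := hf.dist_le_mul (squareProj c) x₀
    rw [hf0, NNReal.coe_one, one_mul, dist_zero_right] at h1
    refine h1.trans ?_
    obtain ⟨h2, h3⟩ := Complex.mem_reProdIm.mp (squareProj c).2
    have h4 : (x₀ : ℂ) = 0 := by apply Complex.ext <;> simp [x₀, squareProj]
    rw [Subtype.dist_eq, h4, dist_zero_right, ← abs_of_nonneg (norm_nonneg _),
      ← abs_of_nonneg (show (0 : ℝ) ≤ 3 by norm_num)]
    refine sq_le_sq.mp ?_
    rw [← Complex.normSq_eq_norm_sq, Complex.normSq_apply]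
    nlinarith [h2.1, h2.2, h3.1, h3.2]
  have hint : ∀ s : Set ℂ, volume s ≠ ⊤ → IntegrableOn F s := fun s hs =>
    Measure.integrableOn_of_bounded hs hFlip.continuous.aestronglyMeasurable
      (ae_of_all _ hFbd)
  have hne : mandelbrotMeasure ≠ 0 := by
    intro h
    have h1 := mass_mandelbrotMeasure
    rw [h] at h1
    simp at h1
    linarith
  have hμ : ∫ x, f x ∂(mandelbrotMeasure.normalize : Measure square) =
      A⁻¹ * ∫ c in mandelbrot, F c := by
    rw [FiniteMeasure.toMeasure_normalize_eq_of_nonzero _ hne, integral_smul_nnreal_measure,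
      mandelbrotMeasure_apply_integral, NNReal.smul_def, NNReal.coe_inv, mass_mandelbrotMeasure,
      smul_eq_mul]
  have hlen : (0 : ℝ) < (keepList farBall k).length := by
    exact_mod_cast List.length_pos_iff.mpr (nonempty_keepList hA)
  have hν : ∫ x, f x ∂(idealMeasure squarePoint
      (uniformCode ((keepList farBall k).map (corner k))) : Measure square) =
      Q⁻¹ * (1 / ((k : ℝ) + 1) ^ 2 *
        ((keepList farBall k).map fun q => F (planePoint (corner k q))).sum) := by
    rw [integral_idealMeasure_uniformCode squarePoint (by simpa using nonempty_keepList hA)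
      hf.continuous, hQ, ratOf_areaCode_eq]
    simp only [List.length_map, List.map_map, Function.comp_def, hF, squareProj_planePoint]
    have : (k : ℝ) + 1 ≠ 0 := by positivity
    field_simp
  have hregion := abs_setIntegral_region_sub_le farBall k hFlip
  have hsub : mandelbrot ⊆ region farBall k := by
    simpa only [diff_farBall] using diff_idealBall_subset_region farBall k
  have hdiff : (∫ c in region farBall k, F c) - ∫ c in mandelbrot, F c =
      ∫ c in region farBall k \ mandelbrot, F c :=
    (setIntegral_sdiff isClosed_mandelbrot.measurableSet
      (hint _ (volume_region_ne_top _ _)) hsub).symm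
  have hD : |(∫ c in region farBall k, F c) - ∫ c in mandelbrot, F c| ≤ 3 * (Q - A) := by
    rw [hdiff, hQ, ← volume_real_region, hAdef, ← measureReal_sdiff hsub
      isClosed_mandelbrot.measurableSet (volume_region_ne_top _ _)]
    exact norm_setIntegral_le_of_norm_le_const
      ((measure_mono Set.sdiff_subset).trans_lt (volume_region_ne_top _ _).lt_top)
      fun c _ => hFbd c
  have hM : |∫ c in mandelbrot, F c| ≤ 3 * A :=
    norm_setIntegral_le_of_norm_le_const volume_mandelbrot_ne_top.lt_top fun c _ => hFbd c
  rw [hμ, hν]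
  set S := 1 / ((k : ℝ) + 1) ^ 2 *
        ((keepList farBall k).map fun q => F (planePoint (corner k q))).sum
  set IU := ∫ c in region farBall k, F c
  set IM := ∫ c in mandelbrot, F c
  have e1 : Q⁻¹ * S - A⁻¹ * IM = Q⁻¹ * (S - IU) + Q⁻¹ * (IU - IM) + (Q⁻¹ - A⁻¹) * IM := by ring
  have b1 : |Q⁻¹ * (S - IU)| ≤ ratOf (meshCode k) := by
    rw [abs_mul, abs_of_pos (inv_pos.mpr hQ0), inv_mul_le_iff₀ hQ0, abs_sub_comm]
    exact hregion
  have b2 : |Q⁻¹ * (IU - IM)| ≤ 3 / A * (Q - A) := by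
    rw [abs_mul, abs_of_pos (inv_pos.mpr hQ0)]
    calc Q⁻¹ * |IU - IM| ≤ A⁻¹ * (3 * (Q - A)) :=
          mul_le_mul (inv_anti₀ hA hAQ) hD (abs_nonneg _) (inv_pos.mpr hA).le
      _ = 3 / A * (Q - A) := by ring
  have b3 : |(Q⁻¹ - A⁻¹) * IM| ≤ 3 / A * (Q - A) := by
    have e3 : |Q⁻¹ - A⁻¹| = Q⁻¹ * (A⁻¹ * (Q - A)) := by
      rw [abs_sub_comm, abs_of_nonneg (sub_nonneg.mpr (inv_anti₀ hA hAQ))]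
      field_simp
    have hAQ' : 0 ≤ A⁻¹ * (Q - A) := mul_nonneg (inv_pos.mpr hA).le (by linarith)
    rw [abs_mul, e3]
    calc Q⁻¹ * (A⁻¹ * (Q - A)) * |IM| ≤ A⁻¹ * (A⁻¹ * (Q - A)) * (3 * A) :=
          mul_le_mul (mul_le_mul_of_nonneg_right (inv_anti₀ hA hAQ) hAQ') hM (abs_nonneg _)
            (mul_nonneg (inv_pos.mpr hA).le hAQ')
      _ = 3 / A * (Q - A) := by field_simp
  rw [e1]
  have := abs_add_three (Q⁻¹ * (S - IU)) (Q⁻¹ * (IU - IM)) ((Q⁻¹ - A⁻¹) * IM)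
  have e4 : 6 / A * (Q - A) = 3 / A * (Q - A) + 3 / A * (Q - A) := by ring
  linarith

theorem isComputableProbabilityMeasure_normalize_mandelbrotMeasure
    (hA : IsComputableReal (volume mandelbrot).toReal) (h0 : 0 < volume.real mandelbrot) :
    IsComputableProbabilityMeasure squarePoint mandelbrotMeasure.normalize := by
  obtain ⟨a, hac, ha⟩ := hA
  -- Only the existence of an integer bound matters: a fixed constant may be built into the
  -- algorithm.
  obtain ⟨C, hC⟩ := exists_nat_gt (6 / volume.real mandelbrot)
  -- A computable majorant of the W₁ error: a_k - 2^(-k) stands in for the unknown area, which it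
  -- never exceeds. As `v` tends to 0, searching for `v k` < 2^(-n) terminates.
  set v : ℕ → RatCode := fun k => addCode (mulCode (natCode C)
    (addCode (addCode (areaCode farBall k) (negCode (a k))) (powCode k))) (meshCode k) with hv
  have hvc : Computable v := by
    have h1 : Computable fun k => areaCode farBall k :=
      primrec_areaCode.to_comp.comp (Computable.const farBall) Computable.id
    exact primrec_addCode.to_comp.comp (primrec_mulCode.to_comp.comp (Computable.const _)
      (primrec_addCode.to_comp.comp (primrec_addCode.to_comp.comp h1
        (primrec_negCode.to_comp.comp hac)) primrec_powCode.to_comp)) primrec_meshCode.to_comp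
  have hv' : ∀ k, (ratOf (v k) : ℝ) =
      C * (ratOf (areaCode farBall k) - ratOf (a k) + (1 / 2) ^ k) + ratOf (meshCode k) := by
    intro k
    rw [← ratOf_powCode]
    simp [hv, sub_eq_add_neg]
  have hvlim : Tendsto (fun k => (ratOf (v k) : ℝ)) atTop (𝓝 0) := by
    have h1 := (((tendsto_ratOf_areaCode_farBall.sub (tendsto_computable_approx ha)).add
      (tendsto_pow_atTop_nhds_zero_of_lt_one (r := (1 / 2 : ℝ)) (by norm_num)
        (by norm_num))).const_mul (C : ℝ)).add tendsto_ratOf_meshCode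
    simp only [Measure.real, sub_self, add_zero, mul_zero] at h1
    simpa only [hv'] using h1
  have htc : Computable₂ fun n k => ltCode (v k) (powCode n) :=
    primrec_ltCode.to_comp.comp (hvc.comp Computable.snd)
      (primrec_powCode.to_comp.comp Computable.fst)
  have htiff : ∀ n k, ltCode (v k) (powCode n) = true ↔ (ratOf (v k) : ℝ) < (1 / 2) ^ n := by
    intro n k
    rw [← ratOf_powCode, Rat.cast_lt, ltCode_iff]
  obtain ⟨g, hg, hgt⟩ := exists_computable_search htc fun n => by
    simp only [htiff]
    exact (hvlim.eventually (gt_mem_nhds (by positivity))).exists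
  refine ⟨fun n => uniformCode ((keepList farBall (g n)).map (corner (g n))), ?_, fun n => ?_⟩
  · have h1 : Primrec fun k => uniformCode ((keepList farBall k).map (corner k)) :=
      primrec_uniformCode.comp (Primrec.list_map
        (primrec_keepList.comp (Primrec.const farBall) Primrec.id) primrec_corner)
    exact h1.to_comp.comp hg
  · refine (wasserstein_uniformCode_le h0 (g n)).trans_lt (lt_of_le_of_lt ?_ ((htiff _ _).mp (hgt n)))
    rw [hv']
    have h1 := volume_mandelbrot_le_areaCode (g n)
    have h2 : dist (ratOf (a (g n)) : ℝ) (volume mandelbrot).toReal < (1 / 2) ^ g n := ha (g n)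
    rw [Real.dist_eq, abs_lt] at h2
    have h3 : (volume mandelbrot).toReal = volume.real mandelbrot := rfl
    refine add_le_add_left (mul_le_mul hC.le ?_ (by linarith) (by positivity)) _
    linarith

theorem isComputableMeasure_mandelbrotMeasure
    (hA : IsComputableReal (volume mandelbrot).toReal) :
    IsComputableMeasure squarePoint mandelbrotMeasure := by
  refine ⟨by rw [mass_mandelbrotMeasure]; exact hA, fun h => ?_⟩
  refine isComputableProbabilityMeasure_normalize_mandelbrotMeasure hA ?_
  rw [← mass_mandelbrotMeasure]
  exact_mod_cast pos_iff_ne_zero.mpr ((FiniteMeasure.mass_nonzero_iff _).mpr h)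

end CompAnalysis

theorem mainTheorem1 :
    -- the complement of the Mandelbrot set is a lower-computable open set
    CompAnalysis.IsLowerComputableOpen CompAnalysis.planePoint CompAnalysis.mandelbrotᶜ ∧
    -- the Mandelbrot set lies in the square, and its area is upper-computable
    CompAnalysis.mandelbrot ⊆ CompAnalysis.square ∧
    CompAnalysis.IsUpperComputableReal (volume CompAnalysis.mandelbrot).toReal ∧
    -- the support of Lebesgue measure restricted to the Mandelbrot set is the Mandelbrot set
    (volume.restrict CompAnalysis.mandelbrot).support = CompAnalysis.mandelbrot ∧
    -- the conditional part
    (CompAnalysis.IsComputableReal (volume CompAnalysis.mandelbrot).toReal →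
      CompAnalysis.IsComputableMeasure CompAnalysis.squarePoint CompAnalysis.mandelbrotMeasure ∧
      CompAnalysis.IsLowerComputableClosed CompAnalysis.planePoint
        (volume.restrict CompAnalysis.mandelbrot).support ∧
      CompAnalysis.IsComputableClosed CompAnalysis.planePoint CompAnalysis.mandelbrot) := by
  have hlow := CompAnalysis.isLowerComputableClosed_mandelbrot
  refine ⟨CompAnalysis.isLowerComputableOpen_compl_mandelbrot,
    CompAnalysis.mandelbrot_subset_square, CompAnalysis.isUpperComputableReal_volume_mandelbrot,
    CompAnalysis.support_restrict_mandelbrot, fun hA => ⟨?_, ?_, ?_⟩⟩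
  · exact CompAnalysis.isComputableMeasure_mandelbrotMeasure hA
  · rw [CompAnalysis.support_restrict_mandelbrot]
    exact hlow hA
  · exact ⟨hlow hA, CompAnalysis.isClosed_mandelbrot,
      CompAnalysis.isLowerComputableOpen_compl_mandelbrot⟩
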